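/- **Theorem 1.1.** Let $d\ge 2$ be an integer and let $\Gamma$ and $\Lambda$ be discrete groups (in particular, countable ones) that are von Neumann equivalent. Then: 1. $\Gamma$ has the $M_d$-approximation-property if and only if $\Lambda$ does. 2. $\Gamma$ is $M_d$-weakly amenable if and only if $\Lambda$ is, and $\Lambda_{CH}(\Gamma,d)=\Lambda_{CH}(\Lambda,d)$ in $[0,\infty]$. 3. $\Gamma$ has the $M_d$-weak-Haagerup-property if and only if $\Lambda$ does, and $\Lambda_{WH}(\Gamma,d)=\Lambda_{WH}(\Lambda,d)$ in $[0,\infty]$. Here the notions are as follows. *Multipliers.* For a discrete group $G$, $M_d(G)$ is the space of bounded functions $\varphi:G\to\mathbb C$ for which there are Hilbert spaces $\mathcal H_0,\dots,\mathcal H_d$ with $\mathcal H_0=\mathcal H_d=\mathbb C$ and bounded maps $\xi_i:G\to B(\mathcal H_i,\mathcal H_{i-1})$ with $\varphi(g_1\cdots g_d)=\xi_1(g_1)\cdots\xi_d(g_d)$ for all $g_1,\dots,g_d\in G$; its norm is $\|\varphi\|_{M_d}=\inf\ \prod_{i=1}^d\sup_{g\in G}\|\xi_i(g)\|$, the infimum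 being over all such factorizations. $X_d(G)$ is the closure in the dual space $M_d(G)^*$ of the functionals $\varphi\mapsto\sum_{g}f(g)\varphi(g)$, $f\in\ell^1(G)$. $A(G)$ is the set of coefficients $x\mapsto\langle\lambda(x)u,v\rangle$, $u,v\in\ell^2(G)$, of the left regular representation $\lambda$, and $c_0(G)$ is the set of functions on $G$ vanishing at infinity. *Approximation properties.* $G$ has the $M_d$-approximation-property if there is a net $(\varphi_i)$ in $A(G)$ with $\varphi_i\to1$ in the topology $\sigma(M_d(G),X_d(G))$. $G$ is $M_d$-weakly amenable if moreover the net can be chosen with $\sup_i\|\varphi_i\|_{M_d}<\infty$; $\Lambda_{CH}(G,d)$ is the infimum of the possible values of $\sup_i\|\varphi_i\|_{M_d}$, and it is $\infty$ if $G$ is not $M_d$-weakly amenable. The $M_d$-weak-Haagerup-property and $\Lambda_{WH}(G,d)$ are defined as $M_d$-weak amenability and $\Lambda_{CH}(G,d)$ are, with $M_d(G)\cap c_0(G)$ in place of $A(G)$. *Von Neumann equivalence.* $\Gamma$ and $\Lambda$ are von Neumann equivalent if there are a nonzero von Neumann algebra $M$ with a faithful normal semifinite trace $\mathrm{Tr}$,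 a homomorphism $\sigma$ from $\Gamma\times\Lambda$ to the group of trace preserving $*$-automorphisms of $M$, and projections $p,q\in M$ with $\mathrm{Tr}(p)<\infty$, $\mathrm{Tr}(q)<\infty$ and $\sum_{s\in\Lambda}\sigma_{(1,s)}(p)=1=\sum_{\gamma\in\Gamma}\sigma_{(\gamma,1)}(q)$ in the strong operator topology. -/

import Mathlib

open scoped ENNReal NNReal Topology ComplexConjugate
open Filter

universe u

noncomputable section

/-! ### The algebra of `M_d`-multipliers of a discrete group -/

/-- The composition `ξ₁(g₁) ξ₂(g₂) ⋯ ξₙ(gₙ) : Kₙ → K₀` of a chain of operator valued maps;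
`ξ i` is the `(i+1)`-st map, with values in the bounded operators `K (i+1) → K i`. -/
def opChain {G : Type u} {K : ℕ → Type u} [∀ i, NormedAddCommGroup (K i)]
    [∀ i, InnerProductSpace ℂ (K i)] (ξ : ∀ i, G → K (i + 1) →L[ℂ] K i) :
    ∀ n : ℕ, (Fin n → G) → (K n →L[ℂ] K 0)
  | 0, _ => ContinuousLinearMap.id ℂ (K 0)
  | n + 1, g => (opChain ξ n (fun i => g i.castSucc)).comp (ξ n (g (Fin.last n)))

/-- A factorization `φ(g₁ ⋯ g_d) = ξ₁(g₁) ⋯ ξ_d(g_d)` through Hilbert spaces `K 0, …, K d`,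
where `K 0` and `K d` are identified with `ℂ` and the maps `ξᵢ` are bounded. (The spaces
and the maps with larger indices play no role.) -/
structure MdFactorization (G : Type u) [Group G] (d : ℕ) (φ : G → ℂ) where
  K : ℕ → Type u
  [normedK : ∀ i, NormedAddCommGroup (K i)]
  [innerK : ∀ i, InnerProductSpace ℂ (K i)]
  [completeK : ∀ i, CompleteSpace (K i)]
  left : K 0 ≃ₗᵢ[ℂ] ℂ
  right : K d ≃ₗᵢ[ℂ] ℂ
  ξ : ∀ i, G → K (i + 1) →L[ℂ] K i
  bounded : ∀ i, BddAbove (Set.range fun g => ‖ξ i g‖)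
  factor : ∀ g : Fin d → G,
    φ (List.ofFn g).prod = left (opChain ξ d g (right.symm 1))

attribute [instance] MdFactorization.normedK MdFactorization.innerK MdFactorization.completeK

/-- `sup ‖ξ₁(g₁)‖ ⋯ sup ‖ξ_d(g_d)‖`. -/
def MdFactorization.bound {G : Type u} [Group G] {d : ℕ} {φ : G → ℂ}
    (F : MdFactorization G d φ) : ℝ :=
  ∏ i ∈ Finset.range d, ⨆ g, ‖F.ξ i g‖

/-- The set `M_d(G)` of `M_d`-multipliers of the discrete group `G`. (Such a function is
automatically bounded, and continuity is void.) -/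
def Md (G : Type u) [Group G] (d : ℕ) : Set (G → ℂ) :=
  {φ | Nonempty (MdFactorization G d φ)}

/-- The norm of `M_d(G)`. -/
def mdNorm {G : Type u} [Group G] (d : ℕ) (φ : G → ℂ) : ℝ :=
  sInf (Set.range fun F : MdFactorization G d φ => F.bound)

theorem opChain_id {G K : Type u} [NormedAddCommGroup K] [InnerProductSpace ℂ K]
    (n : ℕ) (g : Fin n → G) :
    opChain (K := fun _ => K) (fun _ _ => ContinuousLinearMap.id ℂ K) n g =
      ContinuousLinearMap.id ℂ K := by
  induction n with
  | zero => rfl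
  | succ n ih => rw [opChain, ih]; rfl

/-- The constant function `1` is an `M_d`-multiplier. -/
theorem one_mem_Md (G : Type u) [Group G] (d : ℕ) : (1 : G → ℂ) ∈ Md G d := by
  let e : EuclideanSpace ℂ PUnit.{u + 1} ≃ₗᵢ[ℂ] ℂ :=
    (LinearIsometryEquiv.piLpCongrLeft 2 ℂ ℂ (Equiv.ofUnique PUnit.{u + 1} (Fin 1))).trans
      (OrthonormalBasis.singleton (Fin 1) ℂ).repr.symm
  refine ⟨⟨fun _ => EuclideanSpace ℂ PUnit.{u + 1}, e, e,
    fun _ _ => ContinuousLinearMap.id ℂ _, fun _ => ?_, fun g => ?_⟩⟩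
  · exact ⟨‖ContinuousLinearMap.id ℂ (EuclideanSpace ℂ PUnit.{u + 1})‖, by rintro _ ⟨g, rfl⟩; rfl⟩
  · rw [opChain_id]; simp

instance (G : Type u) [Group G] (d : ℕ) : One (Md G d) := ⟨⟨1, one_mem_Md G d⟩⟩

/-- The space `X_d(G)`: the functionals on `M_d(G)` that are limits, in the norm
`‖ω‖ = sup {|ω(φ)| : ‖φ‖_{M_d} ≤ 1}` of the dual space `M_d(G)^*`, of the functionals
`φ ↦ ∑ g, f(g) φ(g)` with `f ∈ ℓ¹(G)`. (Such a limit is automatically linear and bounded; since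
`M_d(G)^*` is complete, this closure of `ℓ¹(G)` is its completion.) -/
def Xd (G : Type u) [Group G] (d : ℕ) : Set (Md G d → ℂ) :=
  {ω | ∀ ε : ℝ, 0 < ε → ∃ f : G → ℂ, Summable (fun g => ‖f g‖) ∧
    ∀ φ : Md G d, ‖ω φ - ∑' g, f g * (φ : G → ℂ) g‖ ≤ ε * mdNorm d (φ : G → ℂ)}

/-- The topology `σ(M_d(G), X_d(G))`: the coarsest one for which all elements of `X_d(G)` are
continuous. -/
abbrev sigmaTopology (G : Type u) [Group G] (d : ℕ) : TopologicalSpace (Md G d) :=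
  ⨅ ω ∈ Xd G d, TopologicalSpace.induced ω inferInstance

/-! ### The Fourier algebra -/

/-- The left regular representation on `ℓ²(G)`: `(λ(x) u)(y) = u(x⁻¹ y)`. -/
def leftRegular {G : Type u} [Group G] (x : G) (u : lp (fun _ : G => ℂ) 2) :
    lp (fun _ : G => ℂ) 2 :=
  ⟨fun y => u (x⁻¹ * y), by
    have hu := (memℓp_gen_iff (p := 2) (by norm_num)).1 u.2
    exact (memℓp_gen_iff (p := 2) (by norm_num)).2
      ((Equiv.mulLeft x⁻¹).summable_iff.2 hu)⟩

/-- The Fourier algebra `A(G)`: all coefficients `x ↦ ⟨λ(x) u, v⟩` of the left regular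
representation. (Mathlib's inner product is linear in the second variable.) -/
def fourierAlgebra (G : Type u) [Group G] : Set (G → ℂ) :=
  {φ | ∃ u v : lp (fun _ : G => ℂ) 2, ∀ x, φ x = inner ℂ v (leftRegular x u)}

/-- `c₀(G)`: the functions vanishing at infinity on the discrete group `G`. -/
def cZero (G : Type u) : Set (G → ℂ) := {φ | Tendsto φ cofinite (𝓝 0)}

/-! ### The approximation properties -/

/-- There is a net `(φᵢ)` in `M_d(G)`, consisting of elements of `S`, that converges to `1` in
the topology `σ(M_d(G), X_d(G))` and has `supᵢ ‖φᵢ‖_{M_d} = C` (possibly `∞`). -/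
def HasMdNet (G : Type u) [Group G] (d : ℕ) (S : Set (G → ℂ)) (C : ℝ≥0∞) : Prop :=
  ∃ (ι : Type u) (_ : Preorder ι) (_ : IsDirectedOrder ι) (_ : Nonempty ι) (φ : ι → Md G d),
    (∀ i, (φ i : G → ℂ) ∈ S) ∧
    Tendsto φ atTop (@nhds _ (sigmaTopology G d) 1) ∧
    ⨆ i, ENNReal.ofReal (mdNorm d (φ i : G → ℂ)) = C

/-- The `M_d`-approximation-property. -/
def MdAP (G : Type u) [Group G] (d : ℕ) : Prop :=
  ∃ C : ℝ≥0∞, HasMdNet G d (fourierAlgebra G) C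

/-- `M_d`-weak-amenability. -/
def MdWeaklyAmenable (G : Type u) [Group G] (d : ℕ) : Prop :=
  ∃ C : ℝ≥0∞, C < ∞ ∧ HasMdNet G d (fourierAlgebra G) C

/-- The `M_d`-Cowling–Haagerup constant `Λ_CH(G, d)`; it is `∞` if `G` is not `M_d`-weakly
amenable. -/
def cowlingHaagerup (G : Type u) [Group G] (d : ℕ) : ℝ≥0∞ :=
  sInf {C | C < ∞ ∧ HasMdNet G d (fourierAlgebra G) C}

/-- The `M_d`-weak-Haagerup-property. -/
def MdWeakHaagerup (G : Type u) [Group G] (d : ℕ) : Prop :=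
  ∃ C : ℝ≥0∞, C < ∞ ∧ HasMdNet G d (cZero G) C

/-- The `M_d`-weak-Haagerup constant `Λ_WH(G, d)`; it is `∞` if `G` does not have the
`M_d`-weak-Haagerup-property. -/
def weakHaagerupConst (G : Type u) [Group G] (d : ℕ) : ℝ≥0∞ :=
  sInf {C | C < ∞ ∧ HasMdNet G d (cZero G) C}

/-! ### Von Neumann equivalence -/

section VNE

variable {H : Type u} [NormedAddCommGroup H] [InnerProductSpace ℂ H] [CompleteSpace H]

/-- A faithful normal semifinite trace on a von Neumann algebra `M ⊆ B(H)`. It is a map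
`M₊ → [0, ∞]`; the values of `toFun` outside the positive cone `M₊` are irrelevant. The order on
`M` is the operator order. -/
structure FNSTrace (M : VonNeumannAlgebra H) where
  toFun : M.toStarSubalgebra → ℝ≥0∞
  map_add : ∀ x y, 0 ≤ x → 0 ≤ y → toFun (x + y) = toFun x + toFun y
  map_smul : ∀ (c : ℝ≥0) (x), 0 ≤ x → toFun (((c : ℝ) : ℂ) • x) = (c : ℝ≥0∞) * toFun x
  tracial : ∀ x, toFun (star x * x) = toFun (x * star x)
  faithful : ∀ x, 0 ≤ x → toFun x = 0 → x = 0
  normal : ∀ (D : Set M.toStarSubalgebra) (x : M.toStarSubalgebra), D.Nonempty →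
    (∀ y ∈ D, 0 ≤ y) → DirectedOn (· ≤ ·) D → IsLUB D x → toFun x = ⨆ y ∈ D, toFun y
  semifinite : ∀ x, 0 ≤ x → x ≠ 0 → ∃ y, 0 ≤ y ∧ y ≤ x ∧ y ≠ 0 ∧ toFun y < ∞

/-- A fundamental domain for an action `σ` of a discrete group `G` on `M`: a projection `p ∈ M`
with `∑ g, σ_g(p) = 1` in the strong operator topology. -/
def IsProjFundamentalDomain {M : VonNeumannAlgebra H} {G : Type u} [Group G]
    (σ : G →* (M.toStarSubalgebra ≃⋆ₐ[ℂ] M.toStarSubalgebra)) (p : M.toStarSubalgebra) : Prop :=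
  IsStarProjection p ∧ ∀ v : H, HasSum (fun g => (σ g p : H →L[ℂ] H) v) v

end VNE

/-- Von Neumann equivalence of discrete groups: there are a nonzero von Neumann algebra `M` with a
faithful normal semifinite trace, and a trace preserving action of `Γ × Λ` on it, such that the
actions of `Λ` and of `Γ` have fundamental domains `p` and `q` of finite trace. -/
def VNE (Γ Λ : Type u) [Group Γ] [Group Λ] : Prop :=
  ∃ (H : Type u) (_ : NormedAddCommGroup H) (_ : InnerProductSpace ℂ H) (_ : CompleteSpace H)
    (_ : Nontrivial H) (M : VonNeumannAlgebra H) (Tr : FNSTrace M)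
    (σ : Γ × Λ →* (M.toStarSubalgebra ≃⋆ₐ[ℂ] M.toStarSubalgebra)) (p q : M.toStarSubalgebra),
    (∀ a x, 0 ≤ x → Tr.toFun (σ a x) = Tr.toFun x) ∧
    IsProjFundamentalDomain (σ.comp (MonoidHom.inr Γ Λ)) p ∧
    IsProjFundamentalDomain (σ.comp (MonoidHom.inl Γ Λ)) q ∧
    Tr.toFun p < ∞ ∧ Tr.toFun q < ∞

end

/-! On `L = L²(M, Tr)` the action gives a unitary representation `u` of `Γ × Λ`, and the normalized
vector `ζ = p / ‖p‖` has `⟨ζ, u(γ, s) ζ⟩ = Tr(p σ_{(γ,s)}(p)) / Tr(p)`. For fixed `γ` these weights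
are nonnegative with sum `1` over `s ∈ Λ`, because the `Λ`-translates of `p` sum to `1`. Averaging
against them (`InductionDatum.induce`) carries functions on `Λ` to functions on `Γ` and fixes the
constant `1`. Von Neumann equivalence is symmetric, so it suffices to carry approximating nets from
`Λ` to `Γ`.

The heart is that induction does not increase the `M_d`-norm (`hasContractiveRep_induce`). A
factorization through maps `ξᵢ` becomes one through the spaces `L ⊗ Kᵢ`, with operators `∑ᵣ P u(γ,
r) P' ⊗ ξᵢ(r)`, where one of `P`, `P'` is left and the other right multiplication by `p`, the roles
alternating with `i`. Left and right multiplications commute even if `M` does not; hence the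
summands have orthogonal ranges and orthogonal initial spaces, and the sum is a contraction
(`exists_htmap_sum`). In the product of `d` such operators the multiple sum collapses to the single
sum that defines induction (`Represents.step`).

Induction is also the adjoint of a map `ℓ¹(Γ) → ℓ¹(Λ)`, so it is continuous for the topologies
`σ(M_d, X_d)` (`comp_induceMd_mem_Xd`). Finally, the translates of `q` make `u` restricted to `Γ`
resemble a multiple of the regular representation: its coefficients are limits in `M_d`-norm of
finitely supported functions. The weights are such coefficients, which gives `induce_mem_cZero`; so
are the functions induced from `A(Λ)` (`exists_induce_eq_coefficient`), which can therefore be moved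
into `A(Γ)` at an arbitrarily small cost in norm. `exists_hasMdNet` lets this cost tend to zero
along the net. -/

section ContractiveRep

/-! ### Factorizations of multipliers by contractions and unit vectors. -/

/-- A representation `φ(g₁ ⋯ g_d) = B ⟨y, ξ₁(g₁) ⋯ ξ_d(g_d) x⟩` with contractions `ξᵢ(g)` and
unit vectors `x`, `y`. -/
def HasContractiveRep (G : Type u) [Group G] (d : ℕ) (φ : G → ℂ) (B : ℝ) : Prop :=
  ∃ (K : ℕ → Type u) (_ : ∀ i, NormedAddCommGroup (K i)) (_ : ∀ i, InnerProductSpace ℂ (K i))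
    (_ : ∀ i, CompleteSpace (K i)) (ξ : ∀ i, G → K (i + 1) →L[ℂ] K i) (y : K 0) (x : K d),
    (∀ i g, ‖ξ i g‖ ≤ 1) ∧ ‖x‖ = 1 ∧ ‖y‖ = 1 ∧
    ∀ g : Fin d → G, φ (List.ofFn g).prod = B * inner ℂ y (opChain ξ d g x)

variable {G : Type u}

section opChain

variable {K : ℕ → Type u} [∀ i, NormedAddCommGroup (K i)] [∀ i, InnerProductSpace ℂ (K i)]

theorem opChain_smul (ξ : ∀ i, G → K (i + 1) →L[ℂ] K i) (a : ℕ → ℂ) (n : ℕ) (g : Fin n → G) :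
    opChain (fun i g => a i • ξ i g) n g = (∏ i ∈ Finset.range n, a i) • opChain ξ n g := by
  induction n with
  | zero => simp [opChain]
  | succ n ih =>
    rw [opChain, ih, opChain, Finset.prod_range_succ]
    ext v
    simp [mul_smul, smul_comm (a n)]

theorem norm_opChain_le (ξ : ∀ i, G → K (i + 1) →L[ℂ] K i) (hξ : ∀ i g, ‖ξ i g‖ ≤ 1) (n : ℕ)
    (g : Fin n → G) : ‖opChain ξ n g‖ ≤ 1 := by
  induction n with
  | zero => exact ContinuousLinearMap.norm_id_le
  | succ n ih =>
    rw [opChain]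
    refine (ContinuousLinearMap.opNorm_comp_le _ _).trans ?_
    exact mul_le_one₀ (ih _) (norm_nonneg _) (hξ _ _)

/-- Only the end spaces are cut down; at the indices in between the projection is the identity, so a
single projection survives, at the left end. -/
theorem opChain_compression [∀ i, CompleteSpace (K i)] (ξ : ∀ i, G → K (i + 1) →L[ℂ] K i)
    (S : ∀ i, Submodule ℂ (K i)) [∀ i, (S i).HasOrthogonalProjection] (d : ℕ)
    (hS : ∀ i, 0 < i → i < d → S i = ⊤) (n : ℕ) (hn : n ≤ d) (g : Fin n → G) (v : S n) :
    opChain (K := fun i => S i)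
      (fun i g => ((S i).orthogonalProjectionOnto.comp (ξ i g)).comp (S (i + 1)).subtypeL) n g v =
      (S 0).orthogonalProjectionOnto (opChain ξ n g v) := by
  induction n with
  | zero => simp [opChain]
  | succ n ih =>
    rw [opChain, opChain, ContinuousLinearMap.comp_apply, ih (by omega)]
    rcases Nat.eq_zero_or_pos n with rfl | h
    · exact Submodule.orthogonalProjectionOnto_mem_subspace_eq_self _
    · have : ∀ w : K n, ((S n).orthogonalProjectionOnto w : K n) = w := fun w =>
        Submodule.starProjection_eq_self_iff.2 (by rw [hS n h (by omega)]; trivial)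
      simp [this]

end opChain

/-- The direct sum of two operators between Hilbert spaces. -/
def directSumMap {E F E' F' : Type*} [NormedAddCommGroup E] [InnerProductSpace ℂ E]
    [NormedAddCommGroup F] [InnerProductSpace ℂ F] [NormedAddCommGroup E']
    [InnerProductSpace ℂ E'] [NormedAddCommGroup F'] [InnerProductSpace ℂ F']
    (S : E →L[ℂ] E') (T : F →L[ℂ] F') : WithLp 2 (E × F) →L[ℂ] WithLp 2 (E' × F') :=
  ((WithLp.prodContinuousLinearEquiv 2 ℂ E' F').symm : E' × F' →L[ℂ] WithLp 2 (E' × F')).comp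
    ((S.prodMap T).comp (WithLp.prodContinuousLinearEquiv 2 ℂ E F : _ →L[ℂ] E × F))

theorem directSumMap_apply {E F E' F' : Type*} [NormedAddCommGroup E] [InnerProductSpace ℂ E]
    [NormedAddCommGroup F] [InnerProductSpace ℂ F] [NormedAddCommGroup E']
    [InnerProductSpace ℂ E'] [NormedAddCommGroup F'] [InnerProductSpace ℂ F']
    (S : E →L[ℂ] E') (T : F →L[ℂ] F') (v : WithLp 2 (E × F)) :
    directSumMap S T v = WithLp.toLp 2 (S v.fst, T v.snd) := rfl

theorem norm_directSumMap_le {E F E' F' : Type*} [NormedAddCommGroup E] [InnerProductSpace ℂ E]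
    [NormedAddCommGroup F] [InnerProductSpace ℂ F] [NormedAddCommGroup E']
    [InnerProductSpace ℂ E'] [NormedAddCommGroup F'] [InnerProductSpace ℂ F']
    {S : E →L[ℂ] E'} {T : F →L[ℂ] F'} (hS : ‖S‖ ≤ 1) (hT : ‖T‖ ≤ 1) :
    ‖directSumMap S T‖ ≤ 1 := by
  refine ContinuousLinearMap.opNorm_le_bound _ zero_le_one fun v => ?_
  rw [one_mul, directSumMap_apply, WithLp.prod_norm_eq_of_L2, WithLp.prod_norm_eq_of_L2]
  have h1 : ‖S v.fst‖ ≤ ‖v.fst‖ := by simpa using S.le_of_opNorm_le hS v.fst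
  have h2 : ‖T v.snd‖ ≤ ‖v.snd‖ := by simpa using T.le_of_opNorm_le hT v.snd
  gcongr <;> assumption

theorem opChain_directSumMap {K K' : ℕ → Type u} [∀ i, NormedAddCommGroup (K i)]
    [∀ i, InnerProductSpace ℂ (K i)] [∀ i, NormedAddCommGroup (K' i)]
    [∀ i, InnerProductSpace ℂ (K' i)] (ξ : ∀ i, G → K (i + 1) →L[ℂ] K i)
    (ξ' : ∀ i, G → K' (i + 1) →L[ℂ] K' i) (n : ℕ) (g : Fin n → G) :
    opChain (K := fun i => WithLp 2 (K i × K' i)) (fun i g => directSumMap (ξ i g) (ξ' i g)) n g =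
      directSumMap (opChain ξ n g) (opChain ξ' n g) := by
  induction n with
  | zero => rfl
  | succ n ih => rw [opChain, ih]; rfl

variable [Group G] {d : ℕ}

theorem HasContractiveRep.of_le {φ : G → ℂ} {B B' : ℝ} (hd : 0 < d) (h : HasContractiveRep G d φ B)
    (hB : 0 ≤ B) (hBB : B ≤ B') (hB' : 0 < B') : HasContractiveRep G d φ B' := by
  obtain ⟨K, _, _, _, ξ, y, x, hξ, hx, hy, hφ⟩ := h
  -- The whole factor `B / B'` goes to the map of index `0`, which occurs in the chain because `0 <
  -- d`.
  let a : ℕ → ℂ := fun i => if i = 0 then ((B / B' : ℝ) : ℂ) else 1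
  have ha : ∀ i, ‖a i‖ ≤ 1 := by
    intro i
    by_cases hi : i = 0
    · simp only [a, hi, if_true, Complex.norm_real, Real.norm_eq_abs]
      rw [abs_of_nonneg (by positivity)]
      exact div_le_one_of_le₀ hBB hB'.le
    · simp [a, hi]
  refine ⟨K, _, _, inferInstance, fun i g => a i • ξ i g, y, x, fun i g => ?_, hx, hy, fun g => ?_⟩
  · rw [norm_smul]
    exact mul_le_one₀ (ha i) (norm_nonneg _) (hξ i g)
  · rw [opChain_smul, hφ, smul_apply, inner_smul_right]
    obtain ⟨n, rfl⟩ : ∃ n, d = n + 1 := ⟨d - 1, by omega⟩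
    rw [Finset.prod_range_succ']
    have : (B' : ℂ) ≠ 0 := by exact_mod_cast hB'.ne'
    simp only [a, Nat.add_eq_zero_iff, one_ne_zero, and_false, if_false, if_true]
    push_cast
    field_simp
    simp

/-- Each map is divided by (slightly more than) its supremum, and the product of these constants is
collected in `P`. -/
theorem exists_hasContractiveRep_of_mdNorm_lt {φ : G → ℂ} (hφ : φ ∈ Md G d) {B : ℝ}
    (h : mdNorm d φ < B) : ∃ P, 0 < P ∧ P < B ∧ HasContractiveRep G d φ P := by
  have : Nonempty (MdFactorization G d φ) := hφ
  obtain ⟨_, ⟨F, rfl⟩, hF⟩ := exists_lt_of_csInf_lt (Set.range_nonempty _) h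
  set c : ℕ → ℝ := fun i => ⨆ g, ‖F.ξ i g‖ with hc
  have hc0 : ∀ i, 0 ≤ c i := fun i => Real.iSup_nonneg fun g => norm_nonneg _
  -- A supremum may vanish; adding a small `δ` to each permits the division and keeps the product
  -- below `B`.
  have hcont : Tendsto (fun δ : ℝ => ∏ i ∈ Finset.range d, (c i + δ)) (𝓝[>] 0)
      (𝓝 (∏ i ∈ Finset.range d, (c i + 0))) := by
    refine tendsto_nhdsWithin_of_tendsto_nhds ?_
    exact Continuous.tendsto (by fun_prop) 0
  have hlt : ∏ i ∈ Finset.range d, (c i + 0) < B := by simpa [c, MdFactorization.bound] using hF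
  obtain ⟨δ, hδB, hδ⟩ := ((hcont.eventually_lt_const hlt).and self_mem_nhdsWithin).exists
  have hδ : 0 < δ := hδ
  have hpos : ∀ i, 0 < c i + δ := fun i => add_pos_of_nonneg_of_pos (hc0 i) hδ
  refine ⟨_, Finset.prod_pos fun i _ => hpos i, hδB, F.K, inferInstance, inferInstance,
    inferInstance, fun i g => ((c i + δ : ℝ) : ℂ)⁻¹ • F.ξ i g, F.left.symm 1, F.right.symm 1,
    fun i g => ?_, by simp, by simp, fun g => ?_⟩
  · rw [norm_smul, norm_inv, Complex.norm_real, Real.norm_of_nonneg (hpos i).le,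
      inv_mul_le_one₀ (hpos i)]
    exact (le_ciSup (F.bounded i) g).trans (le_add_of_nonneg_right hδ.le)
  · rw [opChain_smul (a := fun i => ((c i + δ : ℝ) : ℂ)⁻¹), F.factor,
      smul_apply, inner_smul_right, ← mul_assoc, Complex.ofReal_prod,
      ← Finset.prod_mul_distrib, Finset.prod_eq_one, one_mul, ← F.left.inner_map_map]
    · simp
    · intro i _
      exact mul_inv_cancel₀ (by exact_mod_cast (hpos i).ne')

theorem mdNorm_nonneg (φ : G → ℂ) : 0 ≤ mdNorm d φ :=
  Real.sInf_nonneg fun _ ⟨_, h⟩ => h ▸ Finset.prod_nonneg fun _ _ =>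
    Real.iSup_nonneg fun _ => norm_nonneg _

/-- The end spaces are compressed to the lines spanned by `y` and `x`, which serve as the two copies
of `ℂ`, and `B` is put on the first map. Since `0 < d`, the two ends have different indices. -/
theorem HasContractiveRep.mem_Md_and_mdNorm_le {φ : G → ℂ} {B : ℝ} (hd : 0 < d) (hB : 0 ≤ B)
    (h : HasContractiveRep G d φ B) : φ ∈ Md G d ∧ mdNorm d φ ≤ B := by
  obtain ⟨K, _, _, _, ξ, y, x, hξ, hx, hy, hφ⟩ := h
  let S : ∀ i, Submodule ℂ (K i) := Function.update
    (Function.update (fun i => (⊤ : Submodule ℂ (K i))) 0 (ℂ ∙ y)) d (ℂ ∙ x)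
  have hSd : S d = ℂ ∙ x := Function.update_self ..
  have hS0 : S 0 = ℂ ∙ y := by
    simp only [S]
    rw [Function.update_of_ne hd.ne, Function.update_self]
  have hS : ∀ i, i ≠ 0 → i ≠ d → S i = ⊤ := by
    intro i h0 h1
    simp only [S]
    rw [Function.update_of_ne h1, Function.update_of_ne h0]
  have hcomp : ∀ i, CompleteSpace (S i) := by
    intro i
    by_cases h1 : i = d
    · subst h1; rw [hSd]; infer_instance
    by_cases h0 : i = 0
    · subst h0; rw [hS0]; infer_instance
    · rw [hS i h0 h1]
      exact isClosed_univ.completeSpace_coe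
  let a : ℕ → ℂ := fun i => if i = 0 then (B : ℂ) else 1
  let η : ∀ i, G → S (i + 1) →L[ℂ] S i := fun i g =>
    ((S i).orthogonalProjectionOnto.comp (ξ i g)).comp (S (i + 1)).subtypeL
  have hη : ∀ i g, ‖η i g‖ ≤ 1 := fun i g => by
    refine (ContinuousLinearMap.opNorm_comp_le _ _).trans
      (mul_le_one₀ ?_ (norm_nonneg _) (Submodule.norm_subtypeL_le _))
    exact (ContinuousLinearMap.opNorm_comp_le _ _).trans
      (mul_le_one₀ (Submodule.orthogonalProjectionOnto_norm_le _) (norm_nonneg _) (hξ i g))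
  have hbd : ∀ i g, ‖a i • η i g‖ ≤ if i = 0 then B else 1 := by
    intro i g
    refine (ContinuousLinearMap.opNorm_smul_le _ _).trans
      ((mul_le_of_le_one_right (norm_nonneg _) (hη i g)).trans ?_)
    by_cases hi : i = 0
    · simp [a, hi, abs_of_nonneg hB]
    · simp [a, hi]
  let left : S 0 ≃ₗᵢ[ℂ] ℂ := (LinearIsometryEquiv.ofEq (S 0) (ℂ ∙ y) hS0).trans
    (LinearIsometryEquiv.toSpanUnitSingleton y hy).symm
  let right : S d ≃ₗᵢ[ℂ] ℂ := (LinearIsometryEquiv.ofEq (S d) (ℂ ∙ x) hSd).trans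
    (LinearIsometryEquiv.toSpanUnitSingleton x hx).symm
  have hleft : ((left.symm 1 : S 0) : K 0) = y := by simp [left]
  have hright : ((right.symm 1 : S d) : K d) = x := by simp [right]
  have hfac : ∀ g : Fin d → G, φ (List.ofFn g).prod =
      left (opChain (K := fun i => S i) (fun i g => a i • η i g) d g (right.symm 1)) := by
    intro g
    have h1 : ∀ z : S 0, left z = inner ℂ y (z : K 0) := by
      intro z
      rw [← hleft, ← Submodule.coe_inner, ← left.inner_map_map]
      simp
    rw [h1, opChain_smul, smul_apply, hφ, opChain_compression ξ S d
      (fun i h0 h1 => hS i h0.ne' h1.ne) d le_rfl, hright, Submodule.coe_smul, inner_smul_right]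
    have : ∏ i ∈ Finset.range d, a i = B := by
      obtain ⟨n, rfl⟩ : ∃ n, d = n + 1 := ⟨d - 1, by omega⟩
      rw [Finset.prod_range_succ']
      simp [a]
    rw [this, ← hleft, ← Submodule.coe_inner, Submodule.inner_orthogonalProjectionOnto_eq_of_mem_left]
  let F : MdFactorization G d φ :=
    { K := fun i => S i
      left := left
      right := right
      ξ := fun i g => a i • η i g
      bounded := fun i => ⟨_, by rintro _ ⟨g, rfl⟩; exact hbd i g⟩
      factor := hfac }
  refine ⟨⟨F⟩, (csInf_le (a := F.bound) ⟨0, ?_⟩ (Set.mem_range_self F)).trans ?_⟩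
  · rintro _ ⟨F, rfl⟩
    exact Finset.prod_nonneg fun i _ => Real.iSup_nonneg fun _ => norm_nonneg _
  · refine (Finset.prod_le_prod (fun i _ => Real.iSup_nonneg fun _ => norm_nonneg _)
      (fun i _ => ciSup_le (hbd i))).trans ?_
    obtain ⟨n, rfl⟩ : ∃ n, d = n + 1 := ⟨d - 1, by omega⟩
    rw [Finset.prod_range_succ']
    simp

theorem HasContractiveRep.norm_apply_le {φ : G → ℂ} {B : ℝ} (hd : 0 < d) (hB : 0 ≤ B)
    (h : HasContractiveRep G d φ B) (g : G) : ‖φ g‖ ≤ B := by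
  obtain ⟨K, _, _, _, ξ, y, x, hξ, hx, hy, hφ⟩ := h
  obtain ⟨n, rfl⟩ : ∃ n, d = n + 1 := ⟨d - 1, by omega⟩
  have h1 := hφ (Fin.cons g fun _ => 1)
  have h2 : (List.ofFn (Fin.cons g fun _ => 1 : Fin (n + 1) → G)).prod = g := by
    simp [List.ofFn_succ]
  rw [h2] at h1
  rw [h1, norm_mul, Complex.norm_real, Real.norm_of_nonneg hB]
  refine mul_le_of_le_one_right hB ((norm_inner_le_norm _ _).trans ?_)
  rw [hy, one_mul]
  refine (ContinuousLinearMap.le_opNorm _ _).trans ?_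
  rw [hx, mul_one]
  exact norm_opChain_le ξ hξ _ _

theorem norm_apply_le_mdNorm (hd : 0 < d) {φ : G → ℂ} (hφ : φ ∈ Md G d) (g : G) :
    ‖φ g‖ ≤ mdNorm d φ := by
  refine le_of_forall_gt_imp_ge_of_dense fun B hB => ?_
  obtain ⟨P, hP, hPB, h⟩ := exists_hasContractiveRep_of_mdNorm_lt hφ hB
  exact (h.norm_apply_le hd hP.le g).trans hPB.le

/-- The direct sum of the two factorizations. The weights `√(B / (B + B'))` and `√(B' / (B + B'))`
keep the end vectors of norm one and restore the constants `B` and `B'` in the pairing. This is the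
triangle inequality for the `M_d`-norm. -/
theorem HasContractiveRep.add {φ φ' : G → ℂ} {B B' : ℝ} (hB : 0 < B) (hB' : 0 < B')
    (h : HasContractiveRep G d φ B) (h' : HasContractiveRep G d φ' B') :
    HasContractiveRep G d (φ + φ') (B + B') := by
  obtain ⟨K, _, _, _, ξ, y, x, hξ, hx, hy, hφ⟩ := h
  obtain ⟨K', _, _, _, ξ', y', x', hξ', hx', hy', hφ'⟩ := h'
  set α : ℝ := √(B / (B + B')) with hα
  set β : ℝ := √(B' / (B + B')) with hβ
  have hα2 : α ^ 2 = B / (B + B') := Real.sq_sqrt (by positivity)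
  have hβ2 : β ^ 2 = B' / (B + B') := Real.sq_sqrt (by positivity)
  have hunit : α ^ 2 + β ^ 2 = 1 := by rw [hα2, hβ2]; field_simp
  have hnorm : ∀ {E F : Type u} [NormedAddCommGroup E] [InnerProductSpace ℂ E]
      [NormedAddCommGroup F] [InnerProductSpace ℂ F] (e : E) (f : F), ‖e‖ = 1 → ‖f‖ = 1 →
      ‖WithLp.toLp 2 ((α : ℂ) • e, (β : ℂ) • f)‖ = 1 := by
    intro E F _ _ _ _ e f he hf
    rw [WithLp.prod_norm_eq_of_L2]
    simp [norm_smul, he, hf, hunit]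
  refine ⟨fun i => WithLp 2 (K i × K' i), inferInstance, inferInstance, inferInstance,
    fun i g => directSumMap (ξ i g) (ξ' i g), WithLp.toLp 2 ((α : ℂ) • y, (β : ℂ) • y'),
    WithLp.toLp 2 ((α : ℂ) • x, (β : ℂ) • x'), fun i g => norm_directSumMap_le (hξ i g) (hξ' i g),
    hnorm _ _ hx hx', hnorm _ _ hy hy', fun g => ?_⟩
  rw [opChain_directSumMap, directSumMap_apply, WithLp.prod_inner_apply, Pi.add_apply, hφ, hφ']
  simp only [map_smul, inner_smul_left, inner_smul_right, Complex.conj_ofReal, WithLp.toLp_fst,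
    WithLp.toLp_snd]
  have h1 : (α : ℂ) * α = B / (B + B') := by rw [← sq]; exact_mod_cast hα2
  have h2 : (β : ℂ) * β = B' / (B + B') := by rw [← sq]; exact_mod_cast hβ2
  rw [← mul_assoc, ← mul_assoc, h1, h2]
  have : (B : ℂ) + B' ≠ 0 := by exact_mod_cast (add_pos hB hB').ne'
  push_cast
  field_simp

/-- Since `π` is multiplicative, the chain with every map equal to `π` is a factorization. -/
theorem hasContractiveRep_coefficient (hd : 0 < d) {L : Type u} [NormedAddCommGroup L]
    [InnerProductSpace ℂ L] [CompleteSpace L] (π : G →* (L →L[ℂ] L)) (hπ : ∀ g, ‖π g‖ ≤ 1)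
    (a b : L) {B : ℝ} (hB : 0 < B) (hab : ‖a‖ * ‖b‖ ≤ B) :
    HasContractiveRep G d (fun g => inner ℂ a (π g b)) B := by
  have hchain : ∀ n (g : Fin n → G), opChain (K := fun _ => L) (fun _ => π) n g =
      π (List.ofFn g).prod := by
    intro n
    induction n with
    | zero => intro g; simp [opChain]; rfl
    | succ n ih =>
      intro g
      rw [opChain, ih, List.ofFn_succ', List.concat_eq_append, List.prod_append, map_mul]
      simp
      rfl
  by_cases ha : a = 0 ∨ b = 0
  · refine HasContractiveRep.of_le hd (B := 0) ?_ le_rfl hB.le hB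
    let v : EuclideanSpace ℂ PUnit.{u + 1} := WithLp.toLp 2 fun _ => 1
    have hv : ‖v‖ = 1 := by simp [v, EuclideanSpace.norm_eq]
    refine ⟨fun _ => EuclideanSpace ℂ PUnit.{u + 1}, inferInstance, inferInstance, inferInstance,
      fun _ _ => 0, v, v, by simp, hv, hv, fun g => ?_⟩
    rcases ha with rfl | rfl <;> simp
  · push Not at ha
    have ha' := norm_pos_iff.2 ha.1
    have hb' := norm_pos_iff.2 ha.2
    refine HasContractiveRep.of_le hd (B := ‖a‖ * ‖b‖) ?_ (by positivity) hab hB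
    refine ⟨fun _ => L, inferInstance, inferInstance, inferInstance, fun _ => π,
      ((‖a‖⁻¹ : ℝ) : ℂ) • a, ((‖b‖⁻¹ : ℝ) : ℂ) • b, fun _ => hπ, ?_, ?_, fun g => ?_⟩
    · simp [norm_smul, ha.2]
    · simp [norm_smul, ha.1]
    · rw [hchain]
      simp only [map_smul, inner_smul_left, inner_smul_right, Complex.conj_ofReal]
      have h1 : (‖a‖ : ℂ) ≠ 0 := by exact_mod_cast ha'.ne'
      have h2 : (‖b‖ : ℂ) ≠ 0 := by exact_mod_cast hb'.ne'
      push_cast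
      field_simp

end ContractiveRep

/-! ### Orthogonal projections with sum one. -/

section Partition

/-- A family of projections with sum `1` in the strong operator topology. -/
structure IsPartition {ι K : Type*} [NormedAddCommGroup K] [InnerProductSpace ℂ K]
    (E : ι → K →L[ℂ] K) : Prop where
  symm : ∀ r x y, inner ℂ (E r x) y = inner ℂ x (E r y)
  idem : ∀ r x, E r (E r x) = E r x
  hasSum : ∀ x, HasSum (fun r => E r x) x

namespace IsPartition

variable {ι K : Type*} [NormedAddCommGroup K] [InnerProductSpace ℂ K] {E : ι → K →L[ℂ] K}

theorem inner_self (h : IsPartition E) (r : ι) (x : K) : inner ℂ x (E r x) = (‖E r x‖ : ℂ) ^ 2 := by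
  rw [← h.idem r x, ← h.symm, h.idem]
  exact inner_self_eq_norm_sq_to_K _

theorem hasSum_norm_sq (h : IsPartition E) (x : K) :
    HasSum (fun r => ‖E r x‖ ^ 2) (‖x‖ ^ 2) := by
  have h1 := (innerSL ℂ x).hasSum (h.hasSum x)
  simp only [innerSL_apply_apply, h.inner_self, inner_self_eq_norm_sq_to_K] at h1
  exact (RCLike.hasSum_ofReal ℂ).1 (by simpa using h1)

theorem norm_apply_le (h : IsPartition E) (r : ι) (x : K) : ‖E r x‖ ≤ ‖x‖ := by
  have := le_hasSum (h.hasSum_norm_sq x) r fun _ _ => by positivity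
  exact le_of_sq_le_sq this (norm_nonneg _)

/-- In the expansion of `‖E s x‖ ^ 2` the term of index `s` already exhausts the norm, so
orthogonality need not be assumed. -/
theorem apply_apply_of_ne (h : IsPartition E) {r s : ι} (hrs : r ≠ s) (x : K) :
    E r (E s x) = 0 := by
  classical
  have h1 := h.hasSum_norm_sq (E s x)
  have h2 := sum_le_hasSum {s, r} (fun _ _ => by positivity) h1
  rw [Finset.sum_pair hrs.symm, h.idem] at h2
  have : ‖E r (E s x)‖ ^ 2 = 0 := le_antisymm (by linarith) (by positivity)
  simpa using this

theorem ext (h : IsPartition E) {x y : K} (hxy : ∀ r, E r x = E r y) : x = y :=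
  (h.hasSum x).unique (by simpa only [hxy] using h.hasSum y)

theorem conjugate (h : IsPartition E) (V W : K →L[ℂ] K) (hVW : ∀ x, V (W x) = x)
    (hWV : ∀ x, W (V x) = x) (hadj : ∀ x y, inner ℂ (V x) y = inner ℂ x (W y)) :
    IsPartition fun r => V.comp ((E r).comp W) where
  symm r x y := by
    have hadj' : ∀ x y, inner ℂ (W x) y = inner ℂ x (V y) := fun x y => by
      rw [← inner_conj_symm, ← hadj, inner_conj_symm]
    simp [hadj, hadj', h.symm]
  idem r x := by simp [hWV, h.idem]
  hasSum x := by
    have := V.hasSum (h.hasSum (W x))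
    rwa [hVW] at this

theorem reindex {κ : Type*} (h : IsPartition E) (e : κ ≃ ι) : IsPartition fun r => E (e r) where
  symm _ := h.symm _
  idem _ := h.idem _
  hasSum x := e.hasSum_iff.2 (h.hasSum x)

theorem inner_eq_zero (h : IsPartition E) {r s : ι} (hrs : r ≠ s) {x y : K} (hx : E r x = x)
    (hy : E s y = y) : inner ℂ x y = 0 := by
  rw [← hx, ← hy, h.symm, h.apply_apply_of_ne hrs, inner_zero_right]

theorem orthogonalFamily (h : IsPartition E) :
    OrthogonalFamily ℂ (fun r => ((E r).toLinearMap.range : Submodule ℂ K))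
      fun _ => Submodule.subtypeₗᵢ _ := by
  rintro _ _ hrs ⟨_, x, rfl⟩ ⟨_, y, rfl⟩
  exact h.inner_eq_zero hrs (h.idem _ x) (h.idem _ y)

theorem summable [CompleteSpace K] (h : IsPartition E) {y : ι → K} (hy : ∀ r, E r (y r) = y r)
    (hsum : Summable fun r => ‖y r‖ ^ 2) : Summable y :=
  (h.orthogonalFamily.summable_iff_norm_sq_summable fun r => ⟨y r, y r, hy r⟩).2 hsum

theorem apply_tsum (h : IsPartition E) {y : ι → K} (hy : ∀ r, E r (y r) = y r) {z : K}
    (hz : HasSum y z) (r : ι) : E r z = y r := by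
  refine ((E r).hasSum hz).unique ?_
  have := hasSum_single (f := fun s => E r (y s)) r fun s hs => by
    rw [← hy s]; exact h.apply_apply_of_ne hs.symm _
  simpa [hy] using this

/-- Finite sums of mutually orthogonal projections are contractions, so strong convergence spreads
from a dense set to the whole space. -/
theorem of_dense (symm : ∀ r x y, inner ℂ (E r x) y = inner ℂ x (E r y))
    (idem : ∀ r x, E r (E r x) = E r x) (ortho : ∀ r s, r ≠ s → ∀ x, E r (E s x) = 0)
    {S : Set K} (hS : Dense S) (hsum : ∀ x ∈ S, HasSum (fun r => E r x) x) : IsPartition E where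
  symm := symm
  idem := idem
  hasSum x := by
    classical
    have hbound : ∀ (F : Finset ι) (x : K), ‖∑ r ∈ F, E r x‖ ≤ ‖x‖ := by
      intro F x
      have h1 : ∀ z, E z (∑ r ∈ F, E r x) = if z ∈ F then E z x else 0 := by
        intro z
        rw [map_sum]
        split_ifs with hz
        · rw [Finset.sum_eq_single z (fun s _ hs => ortho z s hs.symm x) (fun h => (h hz).elim),
            idem]
        · exact Finset.sum_eq_zero fun s hs => ortho z s (fun h => hz (h ▸ hs)) x
      have h2 : inner ℂ (∑ r ∈ F, E r x) (∑ r ∈ F, E r x) = inner ℂ x (∑ r ∈ F, E r x) := by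
        nth_rewrite 1 [sum_inner]
        rw [inner_sum]
        refine Finset.sum_congr rfl fun z hz => ?_
        rw [symm, h1, if_pos hz]
      have h3 : ‖∑ r ∈ F, E r x‖ ^ 2 ≤ ‖x‖ * ‖∑ r ∈ F, E r x‖ := by
        have h4 := norm_inner_le_norm (𝕜 := ℂ) x (∑ r ∈ F, E r x)
        rwa [← h2, inner_self_eq_norm_sq_to_K, norm_pow, RCLike.norm_ofReal, abs_norm] at h4
      by_contra hlt
      push Not at hlt
      nlinarith [norm_nonneg x]
    rw [HasSum, SummationFilter.unconditional_filter, Metric.tendsto_nhds]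
    intro ε hε
    obtain ⟨y, hy, hxy⟩ := Metric.mem_closure_iff.1 (hS x) (ε / 3) (by positivity)
    have hy' := hsum y hy
    rw [HasSum, SummationFilter.unconditional_filter, Metric.tendsto_nhds] at hy'
    filter_upwards [hy' (ε / 3) (by positivity)] with F hF
    rw [dist_eq_norm] at hxy hF ⊢
    have h5 : ‖∑ r ∈ F, E r (x - y)‖ ≤ ‖x - y‖ := hbound F (x - y)
    have h6 : ∑ r ∈ F, E r x - x =
        ∑ r ∈ F, E r (x - y) + (∑ r ∈ F, E r y - y) - (x - y) := by
      simp only [map_sub, Finset.sum_sub_distrib]; abel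
    rw [h6]
    refine (norm_sub_le _ _).trans_lt ?_
    have := norm_add_le (∑ r ∈ F, E r (x - y)) (∑ r ∈ F, E r y - y)
    linarith

/-- A sum of operators with orthogonal ranges and orthogonal initial spaces. -/
theorem exists_hasSum_apply [CompleteSpace K] (h : IsPartition E) {K' : Type*}
    [NormedAddCommGroup K'] [InnerProductSpace ℂ K'] {F : ι → K' →L[ℂ] K'} (hF : IsPartition F)
    (y : ι → K' →L[ℂ] K) (hy : ∀ r x, E r (y r x) = y r x) (hyF : ∀ r x, ‖y r x‖ ≤ ‖F r x‖) :
    ∃ T : K' →L[ℂ] K, ‖T‖ ≤ 1 ∧ ∀ x, HasSum (fun r => y r x) (T x) := by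
  have hs : ∀ x, Summable fun r => y r x := fun x => h.summable (fun r => hy r x)
    ((hF.hasSum_norm_sq x).summable.of_nonneg_of_le (fun _ => by positivity) fun r => by
      gcongr; exact hyF r x)
  let T : K' →ₗ[ℂ] K :=
    { toFun := fun x => ∑' r, y r x
      map_add' := fun x x' => by simp only [map_add]; exact (hs x).tsum_add (hs x')
      map_smul' := fun c x => by
        simp only [map_smul, RingHom.id_apply]; exact (hs x).tsum_const_smul c }
  have hT : ∀ x, HasSum (fun r => y r x) (T x) := fun x => (hs x).hasSum
  have hbound : ∀ x, ‖T x‖ ≤ 1 * ‖x‖ := by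
    intro x
    rw [one_mul]
    refine le_of_sq_le_sq ?_ (norm_nonneg _)
    refine hasSum_le (fun r => ?_) (h.hasSum_norm_sq (T x)) (hF.hasSum_norm_sq x)
    rw [h.apply_tsum (fun r => hy r x) (hT x) r]
    gcongr
    exact hyF r x
  exact ⟨T.mkContinuous 1 hbound, T.mkContinuous_norm_le zero_le_one _, hT⟩

end IsPartition

end Partition

/-! ### Tensor products of Hilbert spaces and of operators. -/

section HilbertTensor

open UniformSpace TensorProduct

variable {L L' L'' K K' K'' : Type*} [NormedAddCommGroup L] [InnerProductSpace ℂ L]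
  [NormedAddCommGroup L'] [InnerProductSpace ℂ L'] [NormedAddCommGroup L'']
  [InnerProductSpace ℂ L''] [NormedAddCommGroup K] [InnerProductSpace ℂ K]
  [NormedAddCommGroup K'] [InnerProductSpace ℂ K'] [NormedAddCommGroup K'']
  [InnerProductSpace ℂ K'']

/-- The elementary tensor in the Hilbert space tensor product. -/
noncomputable def htmul (v : L) (w : K) : Completion (L ⊗[ℂ] K) := ((v ⊗ₜ[ℂ] w : L ⊗[ℂ] K) : Completion _)

/-- The map `v ↦ v ⊗ w` into the Hilbert space tensor product. -/
noncomputable def htmulL (w : K) : L →L[ℂ] Completion (L ⊗[ℂ] K) :=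
  (Completion.toComplL (𝕜 := ℂ)).comp ((TensorProduct.mkL ℂ L K).flip w)

theorem htmulL_apply (v : L) (w : K) : htmulL w v = htmul v w := by
  simp [htmulL, htmul]

theorem inner_htmul (v v' : L) (w w' : K) :
    inner ℂ (htmul v w) (htmul v' w') = inner ℂ v v' * inner ℂ w w' := by
  rw [htmul, htmul, Completion.inner_coe, TensorProduct.inner_tmul]

theorem norm_htmul (v : L) (w : K) : ‖htmul v w‖ = ‖v‖ * ‖w‖ := by
  rw [htmul, Completion.norm_coe, TensorProduct.norm_tmul]

theorem htmul_induction {p : Completion (L ⊗[ℂ] K) → Prop} (hc : IsClosed {x | p x})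
    (hadd : ∀ x y, p x → p y → p (x + y)) (ht : ∀ v w, p (htmul v w)) (x) : p x := by
  refine Completion.induction_on x hc fun x => ?_
  induction x using TensorProduct.induction_on with
  | zero => simpa [htmul] using ht 0 0
  | tmul v w => exact ht v w
  | add x y hx hy => rw [Completion.coe_add]; exact hadd _ _ hx hy

/-- The tensor product of two operators. -/
noncomputable def htmap (A : L →L[ℂ] L') (T : K →L[ℂ] K') :
    Completion (L ⊗[ℂ] K) →L[ℂ] Completion (L' ⊗[ℂ] K') :=
  (TensorProduct.mapL A T).completion

theorem htmap_htmul (A : L →L[ℂ] L') (T : K →L[ℂ] K') (v : L) (w : K) :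
    htmap A T (htmul v w) = htmul (A v) (T w) := by
  simp [htmap, htmul, ContinuousLinearMap.completion_apply_coe]

theorem htmap_ext {V : Type*} [NormedAddCommGroup V] [NormedSpace ℂ V]
    {S T : Completion (L ⊗[ℂ] K) →L[ℂ] V} (h : ∀ v w, S (htmul v w) = T (htmul v w)) : S = T := by
  ext x
  refine htmul_induction (isClosed_eq S.continuous T.continuous) (fun x y hx hy => ?_) h x
  rw [map_add, map_add, hx, hy]

theorem htmap_comp (A : L' →L[ℂ] L'') (A' : L →L[ℂ] L') (T : K' →L[ℂ] K'') (T' : K →L[ℂ] K') :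
    htmap (A.comp A') (T.comp T') = (htmap A T).comp (htmap A' T') :=
  htmap_ext fun v w => by simp [htmap_htmul]

theorem htmap_htmap (A : L' →L[ℂ] L'') (A' : L →L[ℂ] L') (T : K' →L[ℂ] K'') (T' : K →L[ℂ] K')
    (x) : htmap A T (htmap A' T' x) = htmap (A.comp A') (T.comp T') x := by
  rw [htmap_comp]; rfl

theorem norm_htmap_apply_le {A : L →L[ℂ] L'} {T : K →L[ℂ] K'} (hA : ‖A‖ ≤ 1) (hT : ‖T‖ ≤ 1) (x) :
    ‖htmap A T x‖ ≤ ‖x‖ := by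
  refine Completion.induction_on x (isClosed_le (htmap A T).continuous.norm continuous_norm) fun x => ?_
  rw [htmap, ContinuousLinearMap.completion_apply_coe, Completion.norm_coe, Completion.norm_coe]
  have := (TensorProduct.mapL A T).le_of_opNorm_le
    ((TensorProduct.norm_mapL_le A T).trans (mul_le_one₀ hA (norm_nonneg _) hT)) x
  simpa using this

theorem inner_htmap {A : L →L[ℂ] L'} {A' : L' →L[ℂ] L} {T : K →L[ℂ] K'} {T' : K' →L[ℂ] K}
    (hA : ∀ x y, inner ℂ (A x) y = inner ℂ x (A' y))
    (hT : ∀ x y, inner ℂ (T x) y = inner ℂ x (T' y)) (x y) :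
    inner ℂ (htmap A T x) y = inner ℂ x (htmap A' T' y) := by
  refine htmul_induction (p := fun x => inner ℂ (htmap A T x) y = inner ℂ x (htmap A' T' y))
    (isClosed_eq ((htmap A T).continuous.inner continuous_const)
      (continuous_id.inner continuous_const)) (fun x x' hx hx' => ?_) (fun v w => ?_) x
  · rw [map_add, inner_add_left, inner_add_left, hx, hx']
  refine htmul_induction
    (p := fun y => inner ℂ (htmap A T (htmul v w)) y = inner ℂ (htmul v w) (htmap A' T' y))
    (isClosed_eq (continuous_const.inner continuous_id)
      (continuous_const.inner (htmap A' T').continuous)) (fun x x' hx hx' => ?_)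
    (fun v' w' => ?_) y
  · rw [map_add, inner_add_right, inner_add_right, hx, hx']
  · rw [htmap_htmul, htmap_htmul, inner_htmul, inner_htmul, hA, hT]

theorem htmap_zero_left (T : K →L[ℂ] K') : htmap (0 : L →L[ℂ] L') T = 0 :=
  htmap_ext fun v w => by
    rw [htmap_htmul, ← htmulL_apply, zero_apply, map_zero]; rfl

theorem IsPartition.tensor {ι : Type*} {E : ι → L →L[ℂ] L} (h : IsPartition E) :
    IsPartition fun r => htmap (E r) (ContinuousLinearMap.id ℂ K) := by
  have symm : ∀ r (x y : Completion (L ⊗[ℂ] K)), inner ℂ (htmap (E r) (.id ℂ K) x) y =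
      inner ℂ x (htmap (E r) (.id ℂ K) y) :=
    fun r x y => inner_htmap (h.symm r) (fun _ _ => rfl) x y
  have idem : ∀ r (x : Completion (L ⊗[ℂ] K)),
      htmap (E r) (.id ℂ K) (htmap (E r) (.id ℂ K) x) = htmap (E r) (.id ℂ K) x := by
    intro r x
    have : (E r).comp (E r) = E r := ContinuousLinearMap.ext (h.idem r)
    rw [htmap_htmap, this, ContinuousLinearMap.comp_id]
  have ortho : ∀ r s, r ≠ s → ∀ x : Completion (L ⊗[ℂ] K),
      htmap (E r) (.id ℂ K) (htmap (E s) (.id ℂ K) x) = 0 := by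
    intro r s hrs x
    have : (E r).comp (E s) = 0 := ContinuousLinearMap.ext (h.apply_apply_of_ne hrs)
    rw [htmap_htmap, this, htmap_zero_left, zero_apply]
  have hsum : ∀ x : L ⊗[ℂ] K, HasSum (fun r => htmap (E r) (.id ℂ K) (x : Completion (L ⊗[ℂ] K)))
      (x : Completion (L ⊗[ℂ] K)) := by
    intro x
    induction x using TensorProduct.induction_on with
    | zero => simpa only [Completion.coe_zero, map_zero] using hasSum_zero
    | tmul v w =>
      have h1 := (htmulL w).hasSum (h.hasSum v)
      simp only [htmulL_apply] at h1
      have h2 : ∀ r, htmap (E r) (.id ℂ K) (htmul v w) = htmul (E r v) w := fun r =>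
        htmap_htmul _ _ _ _
      simp only [← h2] at h1
      exact h1
    | add x y hx hy => simpa only [Completion.coe_add, map_add] using hx.add hy
  exact IsPartition.of_dense symm idem ortho Completion.denseRange_coe
    (by rintro _ ⟨x, rfl⟩; exact hsum x)

end HilbertTensor

/-! ### Induction of multipliers and its contractivity. -/

section Induction

/-- A unitary representation `u` of `Γ × Λ` together with two projections `P true` and `P false`
that are fundamental domains for `Λ`, such that the translates of one commute with the other,
a fundamental domain `Q` for `Γ`, and a unit vector `ζ` that is fixed by `P true` and `P false` and
cannot tell the translates of `P true` and `P false` apart. -/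
structure InductionDatum (Γ Λ : Type u) [Group Γ] [Group Λ] where
  L : Type u
  [normedL : NormedAddCommGroup L]
  [innerL : InnerProductSpace ℂ L]
  [completeL : CompleteSpace L]
  u : Γ × Λ →* (L →L[ℂ] L)
  inner_u : ∀ g x y, inner ℂ (u g x) y = inner ℂ x (u g⁻¹ y)
  P : Bool → L →L[ℂ] L
  Q : L →L[ℂ] L
  ζ : L
  partition_P : ∀ b, IsPartition fun s : Λ => (u (1, s)).comp ((P b).comp (u (1, s)⁻¹))
  partition_Q : IsPartition fun γ : Γ => (u (γ, 1)).comp (Q.comp (u (γ, 1)⁻¹))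
  comm : ∀ b g x, u g (P b (u g⁻¹ (P (!b) x))) = P (!b) (u g (P b (u g⁻¹ x)))
  P_ζ : ∀ b, P b ζ = ζ
  -- In `L²(M, Tr)`, multiplying `p` by `σ_g(p)` on one side is multiplying `σ_g(p)` by `p` on the
  -- other side.
  conj_ζ : ∀ b g, u g (P b (u g⁻¹ ζ)) = P (!b) (u g ζ)
  norm_ζ : ‖ζ‖ = 1

attribute [instance] InductionDatum.normedL InductionDatum.innerL InductionDatum.completeL

namespace InductionDatum

variable {Γ Λ : Type u} [Group Γ] [Group Λ] (D : InductionDatum Γ Λ)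

theorem u_mul_apply (g h : Γ × Λ) (x : D.L) : D.u (g * h) x = D.u g (D.u h x) := by
  rw [map_mul]; rfl

theorem u_one_apply (x : D.L) : D.u 1 x = x := by
  rw [map_one]; rfl

theorem u_u_inv (g : Γ × Λ) (x : D.L) : D.u g (D.u g⁻¹ x) = x := by
  rw [← u_mul_apply, mul_inv_cancel, u_one_apply]

theorem u_inv_u (g : Γ × Λ) (x : D.L) : D.u g⁻¹ (D.u g x) = x := by
  rw [← u_mul_apply, inv_mul_cancel, u_one_apply]

theorem norm_u_apply (g : Γ × Λ) (x : D.L) : ‖D.u g x‖ = ‖x‖ := by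
  rw [@norm_eq_sqrt_re_inner ℂ, @norm_eq_sqrt_re_inner ℂ, D.inner_u, u_inv_u]

theorem norm_u_le (g : Γ × Λ) : ‖D.u g‖ ≤ 1 :=
  ContinuousLinearMap.opNorm_le_bound _ zero_le_one fun x => by rw [norm_u_apply, one_mul]

/-- The translate of `P b` by `g`. -/
noncomputable def E (b : Bool) (g : Γ × Λ) : D.L →L[ℂ] D.L :=
  (D.u g).comp ((D.P b).comp (D.u g⁻¹))

theorem E_apply (b : Bool) (g : Γ × Λ) (x : D.L) : D.E b g x = D.u g (D.P b (D.u g⁻¹ x)) := rfl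

theorem E_one (b : Bool) (x : D.L) : D.E b 1 x = D.P b x := by
  rw [E_apply, inv_one, u_one_apply, u_one_apply]

theorem u_E (b : Bool) (g h : Γ × Λ) (x : D.L) : D.u g (D.E b h x) = D.E b (g * h) (D.u g x) := by
  rw [E_apply, E_apply, mul_inv_rev, u_mul_apply, u_mul_apply, u_inv_u]

theorem u_P (b : Bool) (g : Γ × Λ) (x : D.L) : D.u g (D.P b x) = D.E b g (D.u g x) := by
  rw [← E_one, u_E, mul_one]

theorem E_P (b : Bool) (g : Γ × Λ) (x : D.L) : D.E b g (D.P (!b) x) = D.P (!b) (D.E b g x) :=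
  D.comm b g x

theorem E_not_P (b : Bool) (g : Γ × Λ) (x : D.L) : D.E (!b) g (D.P b x) = D.P b (D.E (!b) g x) := by
  have := D.comm (!b) g x
  rwa [Bool.not_not] at this

theorem isPartition_E (b : Bool) (γ : Γ) : IsPartition fun s : Λ => D.E b (γ, s) := by
  have h := (D.partition_P b).conjugate (D.u (γ, 1)) (D.u (γ, 1)⁻¹) (D.u_u_inv _) (D.u_inv_u _)
    (D.inner_u _)
  convert h using 2 with s
  ext x
  have h1 : ((γ, s) : Γ × Λ) = (γ, 1) * (1, s) := by simp
  rw [E_apply, h1, mul_inv_rev, u_mul_apply, u_mul_apply]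
  rfl

theorem isPartition_E_inv (b : Bool) (γ : Γ) : IsPartition fun s : Λ => D.E b (γ, s)⁻¹ :=
  (D.isPartition_E b γ⁻¹).reindex (Equiv.inv Λ)

theorem P_P (b : Bool) (x : D.L) : D.P b (D.P b x) = D.P b x := by
  have := (D.isPartition_E b 1).idem 1 x
  rwa [← Prod.one_eq_mk, E_one, E_one] at this

theorem inner_P (b : Bool) (x y : D.L) : inner ℂ (D.P b x) y = inner ℂ x (D.P b y) := by
  have := (D.isPartition_E b 1).symm 1 x y
  rwa [← Prod.one_eq_mk, E_one, E_one] at this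

theorem norm_P_le (b : Bool) : ‖D.P b‖ ≤ 1 :=
  ContinuousLinearMap.opNorm_le_bound _ zero_le_one fun x => by
    have := (D.isPartition_E b 1).norm_apply_le 1 x
    rwa [← Prod.one_eq_mk, E_one, ← one_mul ‖x‖] at this

theorem E_u_ζ (b : Bool) (g : Γ × Λ) : D.E b g (D.u g D.ζ) = D.u g D.ζ := by
  rw [← u_P, D.P_ζ]

theorem norm_P_u_ζ (b : Bool) (g : Γ × Λ) : ‖D.P b (D.u g D.ζ)‖ = ‖D.E b g⁻¹ D.ζ‖ := by
  rw [← D.norm_u_apply g⁻¹, D.u_P, u_inv_u]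

/-- The weights of the induction map, `Tr(p σ_g(p)) / Tr(p)` in the case of the standard
representation. -/
noncomputable def weight (g : Γ × Λ) : ℝ := ‖D.P true (D.u g D.ζ)‖ ^ 2

/-- By `conj_ζ`, `P true (u g ζ)` is `E false g ζ`, the image of `ζ` under a projection; so the
coefficient is a squared norm, hence nonnegative. -/
theorem inner_ζ_u_ζ (g : Γ × Λ) : inner ℂ D.ζ (D.u g D.ζ) = (D.weight g : ℂ) := by
  have h1 : inner ℂ D.ζ (D.u g D.ζ) = inner ℂ D.ζ (D.E false g D.ζ) := by
    nth_rewrite 1 [← D.P_ζ true]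
    rw [D.inner_P, E_apply, D.conj_ζ]
    rfl
  have h2 := (D.isPartition_E false g.1).inner_self g.2 D.ζ
  rw [h1, h2, weight, E_apply, D.conj_ζ]
  push_cast
  rfl

theorem weight_nonneg (g : Γ × Λ) : 0 ≤ D.weight g := by unfold weight; positivity

theorem hasSum_weight (γ : Γ) : HasSum (fun s : Λ => D.weight (γ, s)) 1 := by
  have h := (D.isPartition_E_inv true γ).hasSum_norm_sq D.ζ
  simp only [← D.norm_P_u_ζ, D.norm_ζ, one_pow] at h
  exact h

/-- The function on `Γ` induced by a function on `Λ`. -/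
noncomputable def induce (φ : Λ → ℂ) (γ : Γ) : ℂ := ∑' s : Λ, φ s * D.weight (γ, s)

theorem induce_one : D.induce 1 = 1 := by
  ext γ
  have := (D.hasSum_weight γ)
  rw [← Complex.hasSum_ofReal] at this
  simpa [induce] using this.tsum_eq

open UniformSpace TensorProduct

/-- `T` is the sum over `r` of `P b ∘ u (γ, r) ∘ P (!b) ⊗ ξ r`. Moving `u` to either side turns the
first leg into `P b ∘ E (!b) (γ, r) ∘ u (γ, r)` or `u (γ, r) ∘ E b (γ, r)⁻¹ ∘ P (!b)`. As `P b`
commutes with the translates of `P (!b)`, and conversely, the ranges lie in the orthogonal pieces `E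
(!b) (γ, r)` and the initial spaces in the orthogonal pieces `E b (γ, r)⁻¹`. -/
theorem exists_htmap_sum {K K' : Type*} [NormedAddCommGroup K] [InnerProductSpace ℂ K]
    [NormedAddCommGroup K'] [InnerProductSpace ℂ K'] (b : Bool) (γ : Γ) (ξ : Λ → K' →L[ℂ] K)
    (hξ : ∀ s, ‖ξ s‖ ≤ 1) :
    ∃ T : Completion (D.L ⊗[ℂ] K') →L[ℂ] Completion (D.L ⊗[ℂ] K), ‖T‖ ≤ 1 ∧
      ∀ r x, htmap (D.E (!b) (γ, r)) (.id ℂ K) (T x) =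
        htmap ((D.P b).comp ((D.u (γ, r)).comp (D.P (!b)))) (ξ r) x := by
  have hE := (D.isPartition_E (!b) γ).tensor (K := K)
  have hF := (D.isPartition_E_inv b γ).tensor (K := K')
  have h1 : ∀ r x, htmap (D.E (!b) (γ, r)) (.id ℂ K)
      (htmap ((D.P b).comp ((D.u (γ, r)).comp (D.P (!b)))) (ξ r) x) =
      htmap ((D.P b).comp ((D.u (γ, r)).comp (D.P (!b)))) (ξ r) x := by
    intro r x
    rw [htmap_htmap, ContinuousLinearMap.id_comp]
    congr 2
    ext v
    simp only [ContinuousLinearMap.comp_apply]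
    rw [D.E_not_P, ← D.u_P, D.P_P]
  have h2 : ∀ r x, ‖htmap ((D.P b).comp ((D.u (γ, r)).comp (D.P (!b)))) (ξ r) x‖ ≤
      ‖htmap (D.E b (γ, r)⁻¹) (.id ℂ K') x‖ := by
    intro r x
    have h3 : (D.P b).comp ((D.u (γ, r)).comp (D.P (!b))) =
        ((D.u (γ, r)).comp (D.P (!b))).comp (D.E b (γ, r)⁻¹) := by
      ext v
      simp only [ContinuousLinearMap.comp_apply]
      rw [← D.E_P, D.u_E, mul_inv_cancel, D.E_one]
    have h4 : htmap ((D.P b).comp ((D.u (γ, r)).comp (D.P (!b)))) (ξ r) x =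
        htmap ((D.u (γ, r)).comp (D.P (!b))) (ξ r) (htmap (D.E b (γ, r)⁻¹) (.id ℂ K') x) := by
      rw [htmap_htmap, h3, ContinuousLinearMap.comp_id]
    rw [h4]
    refine norm_htmap_apply_le ?_ (hξ r) _
    exact (ContinuousLinearMap.opNorm_comp_le _ _).trans
      (mul_le_one₀ (D.norm_u_le _) (norm_nonneg _) (D.norm_P_le _))
  obtain ⟨T, hT, hsum⟩ := hE.exists_hasSum_apply hF _ h1 h2
  exact ⟨T, hT, fun r x => hE.apply_tsum (fun r => h1 r x) (hsum x) r⟩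

/-- The vector `X` represents the function `φ` after the first `n` factors of its factorization
have been split off, at the point `a` of `Γ`. -/
def Represents {K : ℕ → Type u} [∀ i, NormedAddCommGroup (K i)] [∀ i, InnerProductSpace ℂ (K i)]
    (φ : Λ → ℂ) (ξ : ∀ i, Λ → K (i + 1) →L[ℂ] K i) (y : K 0) (B : ℝ) (n : ℕ)
    (X : Completion (D.L ⊗[ℂ] K n)) (a : Γ) : Prop :=
  ∀ s : Fin n → Λ, HasSum
    (fun t => φ ((List.ofFn s).prod * t) • htmul (D.P n.bodd (D.u (a, t) D.ζ)) (1 : ℂ))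
    ((B : ℂ) • htmap (.id ℂ D.L) ((innerSL ℂ y).comp (opChain ξ n s)) X)

/-- Under each projection `E (!b) (γ, r)` the operator `T` reduces to its `r`-th term, so that `h`
applies to the tuple `s` extended by `r`. The remaining factor `u (γ, r) ∘ P (!b)` is `E (!b) (γ, r)
∘ u (γ, r)`, which is the same projection of the sum at `γ * a`. -/
theorem Represents.step {K : ℕ → Type u} [∀ i, NormedAddCommGroup (K i)]
    [∀ i, InnerProductSpace ℂ (K i)] {φ : Λ → ℂ} {ξ : ∀ i, Λ → K (i + 1) →L[ℂ] K i} {y : K 0}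
    {B : ℝ} {n : ℕ} {X : Completion (D.L ⊗[ℂ] K (n + 1))} {a : Γ} (hφ : ∀ s, ‖φ s‖ ≤ B)
    (h : D.Represents φ ξ y B (n + 1) X a) (γ : Γ)
    (T : Completion (D.L ⊗[ℂ] K (n + 1)) →L[ℂ] Completion (D.L ⊗[ℂ] K n))
    (hT : ∀ r x, htmap (D.E (!n.bodd) (γ, r)) (.id ℂ (K n)) (T x) =
        htmap ((D.P n.bodd).comp ((D.u (γ, r)).comp (D.P (!n.bodd)))) (ξ n r) x) :
    D.Represents φ ξ y B n (T X) (γ * a) := by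
  intro s
  set b := n.bodd with hb
  have hE := (D.isPartition_E (!b) γ).tensor (K := ℂ)
  have hEa := (D.isPartition_E (!b) (γ * a)).tensor (K := ℂ)
  have hsummable : Summable fun t : Λ =>
      φ ((List.ofFn s).prod * t) • htmul (D.P b (D.u (γ * a, t) D.ζ)) (1 : ℂ) := by
    -- The terms lie in the orthogonal pieces `E (!b) (γ * a, t)`, and their norms are at most `B`
    -- times those of the components of `ζ` in another partition.
    refine hEa.summable (fun t => ?_) ?_
    · rw [map_smul, htmap_htmul, D.E_not_P, D.E_u_ζ, ContinuousLinearMap.id_apply]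
    · have h1 := (((D.isPartition_E_inv b (γ * a)).hasSum_norm_sq D.ζ).summable).mul_left (B ^ 2)
      refine h1.of_nonneg_of_le (fun t => by positivity) fun t => ?_
      rw [norm_smul, norm_htmul, norm_one, mul_one, D.norm_P_u_ζ, mul_pow]
      gcongr
      exact hφ _
  convert hsummable.hasSum using 1
  refine hE.ext fun r => ?_
  have h1 := (h (Fin.snoc s r)).mapL
    (htmap ((D.P b).comp ((D.u (γ, r)).comp (D.P (!b)))) (.id ℂ ℂ))
  have h2 := hsummable.hasSum.mapL (htmap (D.E (!b) (γ, r)) (.id ℂ ℂ))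
  have h3 : htmap (D.E (!b) (γ, r)) (.id ℂ ℂ)
      ((B : ℂ) • htmap (.id ℂ D.L) ((innerSL ℂ y).comp (opChain ξ n s)) (T X)) =
      htmap ((D.P b).comp ((D.u (γ, r)).comp (D.P (!b)))) (.id ℂ ℂ)
        ((B : ℂ) • htmap (.id ℂ D.L)
          ((innerSL ℂ y).comp (opChain ξ (n + 1) (Fin.snoc s r))) X) := by
    have h4 : opChain ξ (n + 1) (Fin.snoc s r) = (opChain ξ n s).comp (ξ n r) := by
      rw [opChain]; simp
    rw [map_smul, map_smul, htmap_htmap, htmap_htmap, h4, ContinuousLinearMap.comp_id,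
      ContinuousLinearMap.id_comp, ContinuousLinearMap.id_comp]
    have h5 := congrArg (htmap (.id ℂ D.L) ((innerSL ℂ y).comp (opChain ξ n s))) (hT r X)
    rw [htmap_htmap, htmap_htmap, ContinuousLinearMap.id_comp, ContinuousLinearMap.id_comp,
      ContinuousLinearMap.comp_id] at h5
    rw [h5]
    rfl
  rw [h3]
  refine h1.unique ?_
  -- Substituting `r * t` for `t` matches `u (γ * a, r * t)` with `u (γ, r)` applied to `u (a, t)`.
  rw [← (Equiv.mulLeft r).hasSum_iff] at h2
  convert h2 using 2 with t
  simp only [Function.comp, Equiv.coe_mulLeft, map_smul, htmap_htmul, Nat.bodd_succ,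
    ContinuousLinearMap.id_apply, ContinuousLinearMap.comp_apply]
  have h6 : (List.ofFn (Fin.snoc s r : Fin (n + 1) → Λ)).prod * t =
      (List.ofFn s).prod * (r * t) := by
    rw [List.ofFn_succ', List.concat_eq_append, List.prod_append]
    simp [mul_assoc]
  have h7 : ((γ * a, r * t) : Γ × Λ) = (γ, r) * (a, t) := rfl
  rw [h6, ← hb, D.P_P, D.E_not_P, h7, D.u_mul_apply, D.u_P]

theorem hasContractiveRep_induce {d : ℕ} (hd : 0 < d) {φ : Λ → ℂ} {B : ℝ} (hB : 0 < B)
    (h : HasContractiveRep Λ d φ B) : HasContractiveRep Γ d (D.induce φ) B := by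
  have hφB := h.norm_apply_le hd hB.le
  obtain ⟨K, _, _, _, ξ, y, x, hξ, hx, hy, hφ⟩ := h
  choose T hT1 hT using fun (i : ℕ) (γ : Γ) => D.exists_htmap_sum i.bodd γ (ξ i) (hξ i)
  -- The factors are split off from the last one backwards, so the new group elements multiply `a`
  -- from the left.
  have key : ∀ n (X : Completion (D.L ⊗[ℂ] K n)) (a : Γ), D.Represents φ ξ y B n X a →
      ∀ γ : Fin n → Γ, D.Represents φ ξ y B 0
        (opChain (K := fun i => Completion (D.L ⊗[ℂ] K i)) T n γ X) ((List.ofFn γ).prod * a) := by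
    intro n
    induction n with
    | zero => intro X a h γ; simpa [opChain] using h
    | succ n ih =>
      intro X a h γ
      have := ih _ _ (h.step D hφB (γ (Fin.last n)) (T n _) (hT n _)) fun i => γ i.castSucc
      rw [List.ofFn_succ', List.concat_eq_append, List.prod_append]
      simpa [opChain, mul_assoc] using this
  -- For `t ≠ 1` the vector `u (1, t) ζ` lies in a piece orthogonal to that of `P`, so only `t = 1`
  -- contributes.
  have base : D.Represents φ ξ y B d (htmul D.ζ x) 1 := by
    intro s
    have h1 := hasSum_single (f := fun t : Λ => φ ((List.ofFn s).prod * t) •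
      htmul (D.P d.bodd (D.u (1, t) D.ζ)) (1 : ℂ)) 1 fun t ht => by
        have h2 := (D.isPartition_E d.bodd 1).apply_apply_of_ne ht.symm (D.u (1, t) D.ζ)
        rw [D.E_u_ζ, ← Prod.one_eq_mk, D.E_one] at h2
        rw [h2, ← htmulL_apply, map_zero, smul_zero]
    convert h1 using 1
    rw [htmap_htmul, mul_one, hφ, ← Prod.one_eq_mk, D.u_one_apply, D.P_ζ, mul_smul]
    simp only [ContinuousLinearMap.comp_apply, ContinuousLinearMap.id_apply, innerSL_apply_apply]
    congr 1
    rw [htmul, htmul, ← Completion.coe_smul, TensorProduct.smul_tmul', TensorProduct.smul_tmul]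
    simp
  refine ⟨fun i => Completion (D.L ⊗[ℂ] K i), inferInstance, inferInstance, inferInstance, T,
    htmul D.ζ y, htmul D.ζ x, hT1, by rw [norm_htmul, D.norm_ζ, hx, one_mul],
    by rw [norm_htmul, D.norm_ζ, hy, one_mul], fun γ => ?_⟩
  have h1 := (key d _ _ base γ) Fin.elim0
  -- With no factor left, pairing with `ζ ⊗ 1` turns the vector-valued sum into the sum of `φ t`
  -- times the weights.
  have h2 := (innerSL ℂ (htmul D.ζ (1 : ℂ))).hasSum h1
  have h3 : ∀ X : Completion (D.L ⊗[ℂ] K 0), inner ℂ (htmul D.ζ (1 : ℂ))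
      (htmap (.id ℂ D.L) ((innerSL ℂ y).comp (opChain ξ 0 Fin.elim0)) X) =
      inner ℂ (htmul D.ζ y) X := by
    intro X
    have h4 := inner_htmap (A := .id ℂ D.L) (A' := .id ℂ D.L)
      (T := ContinuousLinearMap.toSpanSingleton ℂ y) (T' := innerSL ℂ y) (fun _ _ => rfl)
      (fun c z => by simp) (htmul D.ζ (1 : ℂ)) X
    rw [htmap_htmul] at h4
    simp only [ContinuousLinearMap.id_apply, ContinuousLinearMap.toSpanSingleton_apply,
      one_smul] at h4
    exact h4.symm
  simp only [innerSL_apply_apply, inner_smul_right, h3] at h2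
  rw [induce, ← h2.tsum_eq]
  refine tsum_congr fun t => ?_
  rw [inner_htmul, ← D.inner_P, D.P_ζ, mul_one, D.inner_ζ_u_ζ]
  simp

end InductionDatum

end Induction

/-! ### Coefficients of representations that shift a partition. -/

section Coefficients

variable {G : Type u}

theorem lp_summable_norm_sq (v : lp (fun _ : G => ℂ) 2) : Summable fun x => ‖v x‖ ^ 2 := by
  have h := (memℓp_gen_iff (p := 2) (by norm_num)).1 v.2
  simpa using h

variable [Group G]

theorem hasSum_inner_leftRegular (v w : lp (fun _ : G => ℂ) 2) (x : G) :
    HasSum (fun y => conj (v y) * w (x⁻¹ * y)) (inner ℂ v (leftRegular x w)) := by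
  have := lp.hasSum_inner (𝕜 := ℂ) v (leftRegular x w)
  simpa [leftRegular, mul_comm] using this

theorem hasSum_comp_inv_mul {F : G → ℂ} {z : ℂ} (h : HasSum F z) (t : G) :
    HasSum (fun s => F (s⁻¹ * t)) z :=
  ((Equiv.inv G).trans (Equiv.mulRight t)).hasSum_iff.2 h

/-- `|v| |w| ≤ |v|² + |w|²`, and after a change of variables both resulting families are products of
summable ones. -/
theorem summable_conj_mul_translate_mul {v w : G → ℂ} (hv : Summable fun x => ‖v x‖ ^ 2)
    (hw : Summable fun x => ‖w x‖ ^ 2) {c : G → ℝ} (hc0 : ∀ s, 0 ≤ c s) (hc : Summable c) :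
    Summable fun p : G × G => conj (v p.1) * (w (p.2⁻¹ * p.1) * (c p.2 : ℂ)) := by
  have h0 : ∀ x, 0 ≤ ‖v x‖ ^ 2 := fun _ => by positivity
  have h0' : ∀ x, 0 ≤ ‖w x‖ ^ 2 := fun _ => by positivity
  have h5 : Summable fun p : G × G => ‖v p.1‖ ^ 2 * c p.2 :=
    hv.mul_of_nonneg hc h0 hc0
  have h7 : Summable fun p : G × G => ‖w p.1‖ ^ 2 * c p.2 :=
    hw.mul_of_nonneg hc h0' hc0
  let e : G × G ≃ G × G :=
    { toFun := fun p => (p.2⁻¹ * p.1, p.2)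
      invFun := fun p => (p.2 * p.1, p.2)
      left_inv := fun p => by simp
      right_inv := fun p => by simp }
  have h6 : Summable fun p : G × G => ‖w (p.2⁻¹ * p.1)‖ ^ 2 * c p.2 := e.summable_iff.2 h7
  refine (h5.add h6).of_norm_bounded fun p => ?_
  rw [norm_mul, norm_mul, RCLike.norm_conj, Complex.norm_real, Real.norm_of_nonneg (hc0 _),
    ← mul_assoc, ← add_mul]
  refine mul_le_mul_of_nonneg_right ?_ (hc0 _)
  nlinarith [sq_nonneg (‖v p.1‖ - ‖w (p.2⁻¹ * p.1)‖), sq_nonneg ‖v p.1‖,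
    sq_nonneg ‖w (p.2⁻¹ * p.1)‖]

/-- `φ` is the coefficient of the point mass at `1` against the conjugate of `φ`. -/
theorem mem_fourierAlgebra_of_finite_support {φ : G → ℂ} (hφ : (Function.support φ).Finite) :
    φ ∈ fourierAlgebra G := by
  classical
  have hv : Memℓp (fun x => conj (φ x) : G → ℂ) 2 := by
    refine memℓp_gen (summable_of_hasFiniteSupport (hφ.subset fun x hx => ?_))
    contrapose! hx
    simpa using hx
  refine ⟨lp.single 2 1 1, ⟨fun x => conj (φ x), hv⟩, fun x => ?_⟩
  refine HasSum.unique ?_ (hasSum_inner_leftRegular _ _ x)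
  convert hasSum_single x fun y hy => ?_ using 1
  · simp
  · have : x⁻¹ * y ≠ 1 := fun h => hy (inv_mul_eq_one.1 h).symm
    simp [lp.single_apply, this]

variable {L : Type u} [NormedAddCommGroup L] [InnerProductSpace ℂ L]

/-- Cut `a` and `b` down to finite sets `F` and `F'` of pieces. Since `π g` moves the piece `h` to
the piece `g * h`, the coefficient can only be nonzero for `g ∈ F F'⁻¹`. -/
theorem exists_finite_support_approx {π : G →* (L →L[ℂ] L)} {E : G → L →L[ℂ] L}
    (hE : IsPartition E) (hπE : ∀ g h x, π g (E h x) = E (g * h) (π g x)) (a b : L) {ε : ℝ}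
    (hε : 0 < ε) : ∃ a' b', (Function.support fun g => inner ℂ a' (π g b')).Finite ∧
      ‖a - a'‖ * ‖b‖ ≤ ε ∧ ‖a'‖ * ‖b - b'‖ ≤ ε := by
  classical
  have happrox : ∀ (x : L) (δ : ℝ), 0 < δ → ∃ F : Finset G, ‖x - ∑ g ∈ F, E g x‖ < δ := by
    intro x δ hδ
    have h := hE.hasSum x
    rw [HasSum, SummationFilter.unconditional_filter, Metric.tendsto_nhds] at h
    obtain ⟨F, hF⟩ := (h δ hδ).exists
    exact ⟨F, by rwa [dist_comm, dist_eq_norm] at hF⟩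
  have hmul : ∀ c δ : ℝ, 0 ≤ c → δ < ε / (c + 1) → 0 ≤ δ → c * δ ≤ ε := by
    intro c δ hc hδ hδ0
    rw [lt_div_iff₀ (by positivity)] at hδ
    nlinarith
  obtain ⟨F, hF⟩ := happrox a (ε / (‖b‖ + 1)) (by positivity)
  -- The second tolerance involves the norm of the truncated `a`, so `F'` is chosen after `F`.
  obtain ⟨F', hF'⟩ := happrox b (ε / (‖∑ g ∈ F, E g a‖ + 1)) (by positivity)
  refine ⟨_, _, ?_, by rw [mul_comm]; exact hmul _ _ (norm_nonneg _) hF (norm_nonneg _),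
    hmul _ _ (norm_nonneg _) hF' (norm_nonneg _)⟩
  refine (F.image₂ (fun g h => g * h⁻¹) F').finite_toSet.subset fun x hx => ?_
  by_contra hx'
  refine hx ?_
  change inner ℂ _ _ = _
  rw [map_sum, sum_inner]
  refine Finset.sum_eq_zero fun g hg => ?_
  rw [inner_sum]
  refine Finset.sum_eq_zero fun h hh => ?_
  rw [hπE]
  refine hE.inner_eq_zero (r := g) (s := x * h) ?_ (hE.idem _ _) (hE.idem _ _)
  rintro rfl
  exact hx' (Finset.mem_coe.2 (Finset.mem_image₂.2 ⟨x * h, hg, h, hh, by simp⟩))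

theorem inner_sub_inner_eq (π : G →* (L →L[ℂ] L)) (a b a' b' : L) (g : G) :
    inner ℂ a (π g b) - inner ℂ a' (π g b') =
      inner ℂ (a - a') (π g b) + inner ℂ a' (π g (b - b')) := by
  rw [map_sub, inner_sub_left, inner_sub_right]; ring

theorem coefficient_mem_cZero {π : G →* (L →L[ℂ] L)} (hπ : ∀ g, ‖π g‖ ≤ 1) {E : G → L →L[ℂ] L}
    (hE : IsPartition E) (hπE : ∀ g h x, π g (E h x) = E (g * h) (π g x)) (a b : L) :
    (fun g => inner ℂ a (π g b)) ∈ cZero G := by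
  have hle : ∀ (a b : L) g, ‖inner ℂ a (π g b)‖ ≤ ‖a‖ * ‖b‖ := by
    intro a b g
    refine (norm_inner_le_norm _ _).trans ?_
    gcongr
    simpa using (π g).le_of_opNorm_le (hπ g) b
  change Tendsto _ _ _
  rw [Metric.tendsto_nhds]
  intro ε hε
  obtain ⟨a', b', hfin, h1, h2⟩ := exists_finite_support_approx hE hπE a b
    (show 0 < ε / 3 by positivity)
  rw [Filter.eventually_cofinite]
  refine hfin.subset fun g hg => ?_
  contrapose! hg
  have h0 : inner ℂ a' (π g b') = 0 := by simpa using hg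
  have h3 := inner_sub_inner_eq π a b a' b' g
  rw [h0, sub_zero] at h3
  simp only [Set.mem_ofPred_eq, dist_zero_right]
  rw [h3]
  have := norm_add_le (inner ℂ (a - a') (π g b)) (inner ℂ a' (π g (b - b')))
  linarith [hle (a - a') b g, hle a' (b - b') g]

/-- Both signs are needed later: one difference is the error term, the other is added to the induced
function to bound the norm of `ψ`. -/
theorem exists_finite_support_hasContractiveRep [CompleteSpace L] {d : ℕ} (hd : 0 < d)
    {π : G →* (L →L[ℂ] L)} (hπ : ∀ g, ‖π g‖ ≤ 1) {E : G → L →L[ℂ] L} (hE : IsPartition E)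
    (hπE : ∀ g h x, π g (E h x) = E (g * h) (π g x)) (a b : L) {ε : ℝ} (hε : 0 < ε) :
    ∃ ψ : G → ℂ, (Function.support ψ).Finite ∧
      HasContractiveRep G d ((fun g => inner ℂ a (π g b)) - ψ) ε ∧
      HasContractiveRep G d (ψ - fun g => inner ℂ a (π g b)) ε := by
  obtain ⟨a', b', hfin, h1, h2⟩ := exists_finite_support_approx hE hπE a b (half_pos hε)
  refine ⟨_, hfin, ?_, ?_⟩
  · have h := (hasContractiveRep_coefficient hd π hπ (a - a') b (half_pos hε) h1).add (half_pos hε)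
      (half_pos hε) (hasContractiveRep_coefficient hd π hπ a' (b - b') (half_pos hε) h2)
    rw [add_halves] at h
    convert h using 1
    ext g
    exact inner_sub_inner_eq π a b a' b' g
  · have h := (hasContractiveRep_coefficient hd π hπ (-(a - a')) b (half_pos hε)
      (by rwa [norm_neg])).add (half_pos hε) (half_pos hε)
      (hasContractiveRep_coefficient hd π hπ (-a') (b - b') (half_pos hε) (by rwa [norm_neg]))
    rw [add_halves] at h
    convert h using 1
    ext g
    have := inner_sub_inner_eq π a b a' b' g
    simp only [Pi.sub_apply, Pi.add_apply, inner_neg_left]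
    linear_combination -this

end Coefficients

/-! ### Induction preserves decay and coefficients. -/

namespace InductionDatum

variable {Γ Λ : Type u} [Group Γ] [Group Λ] (D : InductionDatum Γ Λ)

/-- The restriction of the representation of `Γ × Λ` to `Γ`. -/
noncomputable def repΓ : Γ →* (D.L →L[ℂ] D.L) := D.u.comp (MonoidHom.inl Γ Λ)

theorem repΓ_apply (γ : Γ) : D.repΓ γ = D.u (γ, 1) := rfl

theorem norm_repΓ_le (γ : Γ) : ‖D.repΓ γ‖ ≤ 1 := D.norm_u_le _

theorem repΓ_partition (g h : Γ) (x : D.L) :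
    D.repΓ g (((D.u (h, 1)).comp (D.Q.comp (D.u (h, 1)⁻¹))) x) =
      ((D.u (g * h, 1)).comp (D.Q.comp (D.u (g * h, 1)⁻¹))) (D.repΓ g x) := by
  have h1 : ((g * h, 1) : Γ × Λ) = (g, 1) * (h, 1) := by simp
  simp only [ContinuousLinearMap.comp_apply, repΓ_apply]
  rw [h1, mul_inv_rev, D.u_mul_apply, D.u_mul_apply, D.u_inv_u]

theorem weight_mem_cZero (s : Λ) : (fun γ => (D.weight (γ, s) : ℂ)) ∈ cZero Γ := by
  have h := coefficient_mem_cZero D.norm_repΓ_le D.partition_Q D.repΓ_partition D.ζ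
    (D.u (1, s) D.ζ)
  convert h using 2 with γ
  rw [repΓ_apply, ← D.u_mul_apply, Prod.mk_mul_mk, mul_one, one_mul, D.inner_ζ_u_ζ]

theorem summable_mul_weight {φ : Λ → ℂ} {B : ℝ} (hφ : ∀ s, ‖φ s‖ ≤ B) (γ : Γ) :
    Summable fun s => φ s * D.weight (γ, s) := by
  refine ((D.hasSum_weight γ).summable.mul_left B).of_norm_bounded fun s => ?_
  rw [norm_mul, Complex.norm_real, Real.norm_of_nonneg (D.weight_nonneg _)]
  gcongr
  · exact D.weight_nonneg _
  · exact hφ s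

/-- Off a finite set `F` the values of `φ` are small and the weights have total mass one; on `F`
only finitely many weights occur, each vanishing at infinity in `γ`. -/
theorem induce_mem_cZero {φ : Λ → ℂ} {B : ℝ} (hφB : ∀ s, ‖φ s‖ ≤ B) (hφ : φ ∈ cZero Λ) :
    D.induce φ ∈ cZero Γ := by
  classical
  have hB : 0 ≤ B := (norm_nonneg _).trans (hφB 1)
  change Tendsto _ _ _
  rw [Metric.tendsto_nhds]
  intro ε hε
  have h1 : ∀ᶠ s in cofinite, ‖φ s‖ < ε / 2 := by
    have := (Metric.tendsto_nhds.1 (show Tendsto _ _ _ from hφ)) (ε / 2) (by positivity)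
    simpa using this
  rw [eventually_cofinite] at h1
  set F := h1.toFinset with hF
  have h2 : Tendsto (fun γ => ∑ s ∈ F, B * ‖(D.weight (γ, s) : ℂ)‖) cofinite (𝓝 0) := by
    have : Tendsto (fun γ => ∑ s ∈ F, B * ‖(D.weight (γ, s) : ℂ)‖) cofinite
        (𝓝 (∑ s ∈ F, B * ‖(0 : ℂ)‖)) :=
      tendsto_finsetSum _ fun s _ => ((D.weight_mem_cZero s).norm).const_mul B
    simpa using this
  filter_upwards [h2.eventually_lt_const (show 0 < ε / 2 by positivity)] with γ hγ
  rw [dist_zero_right, induce]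
  have h3 := D.summable_mul_weight hφB γ
  have hw := D.hasSum_weight γ
  have h4 : ∀ s, ‖φ s * D.weight (γ, s)‖ ≤
      (if s ∈ F then B * ‖(D.weight (γ, s) : ℂ)‖ else 0) + ε / 2 * D.weight (γ, s) := by
    intro s
    have h0 := D.weight_nonneg (γ, s)
    rw [norm_mul]
    split_ifs with hs
    · have := mul_le_mul_of_nonneg_right (hφB s) (norm_nonneg (D.weight (γ, s) : ℂ))
      have : 0 ≤ ε / 2 * D.weight (γ, s) := by positivity
      linarith
    · rw [zero_add, Complex.norm_real, Real.norm_of_nonneg h0]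
      have : ‖φ s‖ < ε / 2 := by simpa [F] using hs
      gcongr
  have h5 : HasSum (fun s => (if s ∈ F then B * ‖(D.weight (γ, s) : ℂ)‖ else 0) +
      ε / 2 * D.weight (γ, s)) ((∑ s ∈ F, B * ‖(D.weight (γ, s) : ℂ)‖) + ε / 2 * 1) := by
    refine HasSum.add ?_ (hw.mul_left _)
    have := hasSum_sum_of_ne_finset_zero (s := F) (L := .unconditional Λ)
      (f := fun s => if s ∈ F then B * ‖(D.weight (γ, s) : ℂ)‖ else 0)
      (fun s hs => if_neg hs)
    rwa [Finset.sum_congr rfl fun s hs => if_pos hs] at this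
  have := tsum_of_norm_bounded h5 h4
  linarith

/-- The vectors `u (1, t)⁻¹ ζ` are orthonormal, so `v` and `w` define `V = ∑ v t • u (1, t)⁻¹ ζ` and
`U` likewise. The pairing of the vector of index `t` with the `γ`-translate of that of index `s⁻¹ *
t` is `weight (γ, s)`, because the actions of `Γ` and `Λ` commute. -/
theorem exists_induce_eq_coefficient {φ v w : Λ → ℂ} (hv : Summable fun x => ‖v x‖ ^ 2)
    (hw : Summable fun x => ‖w x‖ ^ 2)
    (hφ : ∀ s, HasSum (fun t => conj (v t) * w (s⁻¹ * t)) (φ s)) :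
    ∃ a b : D.L, ∀ γ, D.induce φ γ = inner ℂ a (D.repΓ γ b) := by
  have hE : IsPartition fun s : Λ => D.E true (1, s)⁻¹ := D.isPartition_E_inv true 1
  have hsum : ∀ v : Λ → ℂ, (Summable fun x => ‖v x‖ ^ 2) →
      Summable fun t => v t • D.u (1, t)⁻¹ D.ζ := by
    intro v hv
    refine hE.summable (fun t => ?_) ?_
    · rw [map_smul, D.E_u_ζ]
    · simpa [norm_smul, D.norm_u_apply, D.norm_ζ] using hv
  obtain ⟨V, hV⟩ := hsum v hv
  obtain ⟨U, hU⟩ := hsum w hw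
  refine ⟨V, U, fun γ => ?_⟩
  have h1 : ∀ t : Λ, HasSum (fun s => w (s⁻¹ * t) * (D.weight (γ, s) : ℂ))
      (inner ℂ (D.u (1, t)⁻¹ D.ζ) (D.repΓ γ U)) := by
    intro t
    have h2 : HasSum (fun r => inner ℂ (D.u (1, t)⁻¹ D.ζ) (D.repΓ γ (w r • D.u (1, r)⁻¹ D.ζ)))
        (inner ℂ (D.u (1, t)⁻¹ D.ζ) (D.repΓ γ U)) :=
      hU.mapL ((innerSL ℂ (D.u (1, t)⁻¹ D.ζ)).comp (D.repΓ γ))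
    have h3 : ∀ s : Λ, inner ℂ (D.u (1, t)⁻¹ D.ζ)
        (D.repΓ γ (w (s⁻¹ * t) • D.u (1, s⁻¹ * t)⁻¹ D.ζ)) =
        w (s⁻¹ * t) * (D.weight (γ, s) : ℂ) := by
      intro s
      have h4 : ((1, t) : Γ × Λ) * (γ, 1) * (1, s⁻¹ * t)⁻¹ = (γ, s) := by simp
      rw [map_smul, inner_smul_right, D.inner_u, inv_inv, repΓ_apply, ← D.u_mul_apply,
        ← D.u_mul_apply, h4, D.inner_ζ_u_ζ]
    simp only [← h3]
    exact hasSum_comp_inv_mul h2 t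
  have h3 : inner ℂ V (D.repΓ γ U) =
      ∑' t, ∑' s, conj (v t) * (w (s⁻¹ * t) * (D.weight (γ, s) : ℂ)) := by
    have h4 : HasSum (fun t => inner ℂ (D.repΓ γ U) (v t • D.u (1, t)⁻¹ D.ζ))
        (inner ℂ (D.repΓ γ U) V) :=
      hV.mapL (innerSL ℂ (D.repΓ γ U))
    rw [← inner_conj_symm, ← h4.tsum_eq, Complex.conj_tsum]
    refine tsum_congr fun t => ?_
    rw [tsum_mul_left, (h1 t).tsum_eq, inner_conj_symm, inner_smul_left]
  have hprod := summable_conj_mul_translate_mul hv hw (fun s => D.weight_nonneg (γ, s))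
    (D.hasSum_weight γ).summable
  have hcomm := Summable.tsum_comm
    (f := fun t s => conj (v t) * (w (s⁻¹ * t) * (D.weight (γ, s) : ℂ))) hprod
  rw [h3, ← hcomm, induce]
  refine tsum_congr fun s => ?_
  rw [← (hφ s).tsum_eq, ← tsum_mul_right]
  exact tsum_congr fun t => mul_assoc _ _ _

end InductionDatum

/-! ### The functionals in `X_d`. -/

section Predual

variable {G : Type u}

theorem summable_mul_of_bounded {f φ : G → ℂ} {B : ℝ} (hf : Summable fun g => ‖f g‖)
    (hφ : ∀ g, ‖φ g‖ ≤ B) : Summable fun g => f g * φ g := by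
  refine (hf.mul_right B).of_norm_bounded fun g => ?_
  rw [norm_mul]
  gcongr
  exact hφ g

theorem norm_tsum_mul_le {f φ : G → ℂ} {B : ℝ} (hf : Summable fun g => ‖f g‖)
    (hφ : ∀ g, ‖φ g‖ ≤ B) : ‖∑' g, f g * φ g‖ ≤ (∑' g, ‖f g‖) * B := by
  refine tsum_of_norm_bounded (hf.hasSum.mul_right B) fun g => ?_
  rw [norm_mul]
  gcongr
  exact hφ g

/-- `F h = ∑ g, f g * c g h` is the transpose of averaging; it is summable because every row of `c`
has mass one, and the identity is Fubini's theorem. -/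
theorem exists_summable_tsum_mul_eq {H : Type*} {c : G → H → ℝ} (hc0 : ∀ g h, 0 ≤ c g h)
    (hc : ∀ g, HasSum (c g) 1) {f : G → ℂ} (hf : Summable fun g => ‖f g‖) :
    ∃ F : H → ℂ, (Summable fun h => ‖F h‖) ∧ ∀ (φ : H → ℂ) (B : ℝ), (∀ h, ‖φ h‖ ≤ B) →
      ∑' h, F h * φ h = ∑' g, f g * ∑' h, φ h * (c g h : ℂ) := by
  have hprod : Summable fun p : G × H => ‖f p.1‖ * c p.1 p.2 := by
    have h0 : 0 ≤ fun p : G × H => ‖f p.1‖ * c p.1 p.2 := fun p =>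
      mul_nonneg (norm_nonneg _) (hc0 _ _)
    have h1 : (fun g => ∑' h, ‖f g‖ * c g h) = fun g => ‖f g‖ := funext fun g => by
      rw [tsum_mul_left, (hc g).tsum_eq, mul_one]
    have h2 : ∀ g, Summable fun h => ‖f g‖ * c g h := fun g => (hc g).summable.mul_left ‖f g‖
    refine (summable_prod_of_nonneg h0).2 ⟨h2, ?_⟩
    change Summable fun g => ∑' h, ‖f g‖ * c g h
    rw [h1]
    exact hf
  have hprod' : Summable fun p : H × G => ‖f p.2‖ * c p.2 p.1 :=
    (Equiv.prodComm H G).summable_iff.2 hprod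
  have hnorm : ∀ g h, ‖f g * (c g h : ℂ)‖ = ‖f g‖ * c g h := fun g h => by
    rw [norm_mul, Complex.norm_real, Real.norm_of_nonneg (hc0 _ _)]
  refine ⟨fun h => ∑' g, f g * c g h, ?_, fun φ B hφ => ?_⟩
  · refine hprod'.prod.of_nonneg_of_le (fun _ => norm_nonneg _) fun h => ?_
    refine (norm_tsum_le_tsum_norm ?_).trans (le_of_eq ?_)
    · simpa only [hnorm] using hprod'.prod_factor h
    · exact tsum_congr fun g => hnorm g h
  · have hsum : Summable fun p : G × H => f p.1 * (φ p.2 * (c p.1 p.2 : ℂ)) := by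
      refine (hprod.mul_left B).of_norm_bounded fun p => ?_
      rw [mul_left_comm, norm_mul, hnorm]
      have := mul_nonneg (norm_nonneg (f p.1)) (hc0 p.1 p.2)
      gcongr
      exact hφ _
    have hcomm := Summable.tsum_comm (f := fun g h => f g * (φ h * (c g h : ℂ))) hsum
    simp only [← tsum_mul_left, ← tsum_mul_right]
    rw [← hcomm]
    exact tsum_congr fun h => tsum_congr fun g => by ring

variable [Group G] {d : ℕ}

/-- Elements of `Xd` are plain functions, so additivity is inherited from the approximating
`ℓ¹`-functionals. -/
theorem eq_add_of_mem_Xd (hd : 0 < d) {ω : Md G d → ℂ} (hω : ω ∈ Xd G d) {φ ψ δ : Md G d}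
    (h : (φ : G → ℂ) = ψ + δ) : ω φ = ω ψ + ω δ := by
  set N := mdNorm d (φ : G → ℂ) + mdNorm d (ψ : G → ℂ) + mdNorm d (δ : G → ℂ) with hN
  have hN0 : 0 ≤ N := by
    have h1 := mdNorm_nonneg (d := d) (φ : G → ℂ)
    have h2 := mdNorm_nonneg (d := d) (ψ : G → ℂ)
    have h3 := mdNorm_nonneg (d := d) (δ : G → ℂ)
    positivity
  rw [← sub_eq_zero, ← norm_le_zero_iff]
  refine le_of_forall_pos_le_add fun ε hε => ?_
  obtain ⟨f, hf, hfω⟩ := hω (ε / (N + 1)) (by positivity)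
  have hsum : ∑' g, f g * (φ : G → ℂ) g =
      ∑' g, f g * (ψ : G → ℂ) g + ∑' g, f g * (δ : G → ℂ) g := by
    rw [← Summable.tsum_add (summable_mul_of_bounded hf (norm_apply_le_mdNorm hd ψ.2))
      (summable_mul_of_bounded hf (norm_apply_le_mdNorm hd δ.2))]
    exact tsum_congr fun g => by rw [h, Pi.add_apply, mul_add]
  have h4 : ω φ - (ω ψ + ω δ) = (ω φ - ∑' g, f g * (φ : G → ℂ) g) -
      (ω ψ - ∑' g, f g * (ψ : G → ℂ) g) - (ω δ - ∑' g, f g * (δ : G → ℂ) g) := by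
    rw [hsum]; ring
  rw [h4, zero_add]
  refine (norm_sub_le _ _).trans ((add_le_add_left (norm_sub_le _ _) _).trans ?_)
  have h5 : ε / (N + 1) * N ≤ ε := by
    rw [div_mul_eq_mul_div, div_le_iff₀ (by positivity)]
    nlinarith
  have h6 := hfω φ
  have h7 := hfω ψ
  have h8 := hfω δ
  calc _ ≤ ε / (N + 1) * mdNorm d (φ : G → ℂ) + ε / (N + 1) * mdNorm d (ψ : G → ℂ) +
      ε / (N + 1) * mdNorm d (δ : G → ℂ) := by gcongr
    _ = ε / (N + 1) * N := by rw [hN]; ring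
    _ ≤ ε := h5

theorem exists_norm_le_of_mem_Xd (hd : 0 < d) {ω : Md G d → ℂ} (hω : ω ∈ Xd G d) :
    ∃ C, ∀ φ : Md G d, ‖ω φ‖ ≤ C * mdNorm d (φ : G → ℂ) := by
  obtain ⟨f, hf, hfω⟩ := hω 1 one_pos
  refine ⟨1 + ∑' g, ‖f g‖, fun φ => ?_⟩
  have h1 := norm_tsum_mul_le hf (norm_apply_le_mdNorm hd φ.2)
  have h2 := hfω φ
  have h3 := norm_le_norm_add_norm_sub' (ω φ) (∑' g, f g * (φ : G → ℂ) g)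
  rw [add_mul]
  linarith

theorem tendsto_sigmaTopology_iff {ι : Type*} {l : Filter ι} {φ : ι → Md G d} {ψ : Md G d} :
    Tendsto φ l (@nhds _ (sigmaTopology G d) ψ) ↔
      ∀ ω ∈ Xd G d, Tendsto (fun i => ω (φ i)) l (𝓝 (ω ψ)) := by
  simp only [nhds_iInf, nhds_induced, tendsto_iInf, tendsto_comap_iff]
  rfl

end Predual

/-! ### Transport of approximating nets. -/

namespace InductionDatum

variable {Γ Λ : Type u} [Group Γ] [Group Λ] (D : InductionDatum Γ Λ) {d : ℕ}

theorem induce_mem_Md_and_mdNorm_le (hd : 0 < d) {φ : Λ → ℂ} (hφ : φ ∈ Md Λ d) :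
    D.induce φ ∈ Md Γ d ∧ mdNorm d (D.induce φ) ≤ mdNorm d φ := by
  have h : ∀ B, mdNorm d φ < B → D.induce φ ∈ Md Γ d ∧ mdNorm d (D.induce φ) ≤ B := by
    intro B hB
    obtain ⟨P, hP, hPB, hrep⟩ := exists_hasContractiveRep_of_mdNorm_lt hφ hB
    have := (D.hasContractiveRep_induce hd hP hrep).mem_Md_and_mdNorm_le hd hP.le
    exact ⟨this.1, this.2.trans hPB.le⟩
  exact ⟨(h _ (lt_add_one _)).1, le_of_forall_gt_imp_ge_of_dense fun B hB => (h B hB).2⟩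

/-- The induction map on multipliers. -/
noncomputable def induceMd (hd : 0 < d) (φ : Md Λ d) : Md Γ d :=
  ⟨D.induce φ, (D.induce_mem_Md_and_mdNorm_le hd φ.2).1⟩

theorem induceMd_one (hd : 0 < d) : D.induceMd hd 1 = 1 := Subtype.ext D.induce_one

/-- Contractivity of induction lets the same `ε` serve for the transposed `ℓ¹`-function. -/
theorem comp_induceMd_mem_Xd (hd : 0 < d) {ω : Md Γ d → ℂ} (hω : ω ∈ Xd Γ d) :
    (fun φ => ω (D.induceMd hd φ)) ∈ Xd Λ d := by
  intro ε hε
  obtain ⟨f, hf, hfω⟩ := hω ε hε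
  obtain ⟨F, hF, hFφ⟩ := exists_summable_tsum_mul_eq (c := fun γ s => D.weight (γ, s))
    (fun _ _ => D.weight_nonneg _) D.hasSum_weight hf
  refine ⟨F, hF, fun φ => ?_⟩
  have h1 : ∑' s, F s * (φ : Λ → ℂ) s = ∑' γ, f γ * (D.induceMd hd φ : Γ → ℂ) γ :=
    hFφ _ _ (norm_apply_le_mdNorm hd φ.2)
  rw [h1]
  refine (hfω _).trans ?_
  gcongr
  exact (D.induce_mem_Md_and_mdNorm_le hd φ.2).2

theorem exists_approx_fourierAlgebra (hd : 0 < d) {φ : Md Λ d} (hφ : (φ : Λ → ℂ) ∈ fourierAlgebra Λ)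
    {ε : ℝ} (hε : 0 < ε) : ∃ ψ δ : Md Γ d, (ψ : Γ → ℂ) ∈ fourierAlgebra Γ ∧
      (D.induceMd hd φ : Γ → ℂ) = ψ + δ ∧ mdNorm d (δ : Γ → ℂ) ≤ ε ∧
      mdNorm d (ψ : Γ → ℂ) ≤ mdNorm d (φ : Λ → ℂ) + ε := by
  obtain ⟨w, v, hvw⟩ := hφ
  obtain ⟨a, b, hab⟩ := D.exists_induce_eq_coefficient (lp_summable_norm_sq v)
    (lp_summable_norm_sq w) fun s => hvw s ▸ hasSum_inner_leftRegular v w s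
  obtain ⟨ψ, hfin, h1, h2⟩ := exists_finite_support_hasContractiveRep hd D.norm_repΓ_le
    D.partition_Q D.repΓ_partition a b hε
  rw [← funext hab] at h1 h2
  -- `ψ` is the induced function plus `ψ` minus the induced function; the two representations are
  -- added.
  have h3 : ∀ B, mdNorm d (φ : Λ → ℂ) < B → ψ ∈ Md Γ d ∧ mdNorm d ψ ≤ B + ε := by
    intro B hB
    obtain ⟨P, hP, hPB, hrep⟩ := exists_hasContractiveRep_of_mdNorm_lt φ.2 hB
    have h4 := ((D.hasContractiveRep_induce hd hP hrep).add hP hε h2).mem_Md_and_mdNorm_le hd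
      (by positivity)
    rw [add_sub_cancel] at h4
    exact ⟨h4.1, h4.2.trans (by gcongr)⟩
  have h5 := h1.mem_Md_and_mdNorm_le hd hε.le
  refine ⟨⟨ψ, (h3 _ (lt_add_one _)).1⟩, ⟨_, h5.1⟩, mem_fourierAlgebra_of_finite_support hfin, ?_,
    h5.2, ?_⟩
  · exact (add_sub_cancel ψ (D.induce φ)).symm
  · refine le_of_forall_pos_le_add fun η hη => ?_
    have := (h3 _ (lt_add_of_pos_right _ hη)).2
    change mdNorm d ψ ≤ _
    linarith

theorem exists_approx_cZero (hd : 0 < d) {φ : Md Λ d} (hφ : (φ : Λ → ℂ) ∈ cZero Λ)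
    {ε : ℝ} (hε : 0 < ε) : ∃ ψ δ : Md Γ d, (ψ : Γ → ℂ) ∈ cZero Γ ∧
      (D.induceMd hd φ : Γ → ℂ) = ψ + δ ∧ mdNorm d (δ : Γ → ℂ) ≤ ε ∧
      mdNorm d (ψ : Γ → ℂ) ≤ mdNorm d (φ : Λ → ℂ) + ε := by
  -- No correction is necessary here: `δ` is the zero function, presented as the coefficient of zero
  -- vectors.
  have h0 := (hasContractiveRep_coefficient hd D.repΓ D.norm_repΓ_le 0 0 hε
    (by simpa using hε.le)).mem_Md_and_mdNorm_le hd hε.le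
  refine ⟨D.induceMd hd φ, ⟨_, h0.1⟩,
    D.induce_mem_cZero (norm_apply_le_mdNorm hd φ.2) hφ, ?_, h0.2, ?_⟩
  · ext γ; simp
  · exact ((D.induce_mem_Md_and_mdNorm_le hd φ.2).2).trans (le_add_of_nonneg_right hε.le)

/-- The net is indexed by pairs `(i, n)`, with error `ε / (n + 1)`: norms grow by at most `ε`
throughout, while the errors tend to zero and do not affect the limit. -/
theorem exists_hasMdNet (hd : 0 < d) {S : Set (Λ → ℂ)} {S' : Set (Γ → ℂ)}
    (happrox : ∀ φ : Md Λ d, (φ : Λ → ℂ) ∈ S → ∀ ε : ℝ, 0 < ε → ∃ ψ δ : Md Γ d, (ψ : Γ → ℂ) ∈ S' ∧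
      (D.induceMd hd φ : Γ → ℂ) = ψ + δ ∧ mdNorm d (δ : Γ → ℂ) ≤ ε ∧
      mdNorm d (ψ : Γ → ℂ) ≤ mdNorm d (φ : Λ → ℂ) + ε)
    {C : ℝ≥0∞} (h : HasMdNet Λ d S C) {ε : ℝ} (hε : 0 < ε) :
    ∃ C' ≤ C + ENNReal.ofReal ε, HasMdNet Γ d S' C' := by
  obtain ⟨ι, _, _, _, φ, hφS, hφ, hC⟩ := h
  have hpos : ∀ n : ℕ, 0 < ε / (n + 1) := fun n => by positivity
  have hdir : IsDirectedOrder (ι × ULift.{u} ℕ) := ⟨fun p q => by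
    obtain ⟨r, hpr, hqr⟩ := exists_ge_ge p.1 q.1
    obtain ⟨n, hpn, hqn⟩ := exists_ge_ge p.2 q.2
    exact ⟨(r, n), ⟨hpr, hpn⟩, ⟨hqr, hqn⟩⟩⟩
  choose ψ δ hψS hψδ hδ hψ using fun p : ι × ULift.{u} ℕ =>
    happrox (φ p.1) (hφS p.1) _ (hpos p.2.down)
  refine ⟨_, ?_, ι × ULift.{u} ℕ, inferInstance, inferInstance, inferInstance, ψ, hψS, ?_, rfl⟩
  · refine iSup_le fun p => ?_
    refine (ENNReal.ofReal_le_ofReal (hψ p)).trans (ENNReal.ofReal_add_le.trans ?_)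
    refine add_le_add (hC ▸ le_iSup (fun i => ENNReal.ofReal (mdNorm d (φ i : Λ → ℂ))) p.1)
      (ENNReal.ofReal_le_ofReal ?_)
    exact div_le_self hε.le (by simp)
  · rw [tendsto_sigmaTopology_iff] at hφ ⊢
    intro ω hω
    have hfst : Tendsto (fun p : ι × ULift.{u} ℕ => p.1) atTop atTop := by
      rw [← prod_atTop_atTop_eq]; exact tendsto_fst
    have hsnd : Tendsto (fun p : ι × ULift.{u} ℕ => p.2.down) atTop atTop := by
      have h1 : Tendsto (fun n : ULift.{u} ℕ => n.down) atTop atTop :=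
        tendsto_atTop.2 fun n => (eventually_ge_atTop (ULift.up n)).mono fun m hm => hm
      rw [← prod_atTop_atTop_eq]; exact h1.comp tendsto_snd
    have h1 : Tendsto (fun p : ι × ULift.{u} ℕ => ω (D.induceMd hd (φ p.1))) atTop (𝓝 (ω 1)) := by
      have := (hφ _ (D.comp_induceMd_mem_Xd hd hω)).comp hfst
      rwa [D.induceMd_one] at this
    have h2 : Tendsto (fun p => ω (δ p)) atTop (𝓝 0) := by
      obtain ⟨C, hC⟩ := exists_norm_le_of_mem_Xd hd hω
      have h3 : Tendsto (fun p : ι × ULift.{u} ℕ => |C| * (ε / (p.2.down + 1))) atTop (𝓝 0) := by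
        have h4 : Tendsto (fun n : ℕ => |C| * (ε * (1 / ((n : ℝ) + 1)))) atTop
            (𝓝 (|C| * (ε * 0))) :=
          (tendsto_one_div_add_atTop_nhds_zero_nat.const_mul ε).const_mul |C|
        simp only [mul_zero, mul_one_div] at h4
        exact h4.comp hsnd
      refine squeeze_zero_norm (fun p => (hC _).trans ?_) h3
      have h5 := mdNorm_nonneg (d := d) (δ p : Γ → ℂ)
      exact mul_le_mul (le_abs_self C) (hδ p) h5 (abs_nonneg C)
    have h6 := h1.sub h2
    rw [sub_zero] at h6
    refine h6.congr fun p => ?_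
    rw [eq_add_of_mem_Xd hd hω (hψδ p), add_sub_cancel_right]

end InductionDatum

theorem sInf_hasMdNet_le {Γ Λ : Type u} [Group Γ] [Group Λ] {d : ℕ} {S : Set (Λ → ℂ)}
    {S' : Set (Γ → ℂ)}
    (h : ∀ C : ℝ≥0∞, HasMdNet Λ d S C → ∀ ε : ℝ, 0 < ε →
      ∃ C' ≤ C + ENNReal.ofReal ε, HasMdNet Γ d S' C') :
    sInf {C | C < ∞ ∧ HasMdNet Γ d S' C} ≤ sInf {C | C < ∞ ∧ HasMdNet Λ d S C} := by
  refine le_sInf ?_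
  rintro C ⟨hC, hnet⟩
  refine ENNReal.le_of_forall_pos_le_add fun ε hε _ => ?_
  obtain ⟨C', hC', hnet'⟩ := h C hnet ε (by exact_mod_cast hε)
  rw [ENNReal.ofReal_coe_nnreal] at hC'
  have hlt : C' < ∞ := hC'.trans_lt (ENNReal.add_lt_top.2 ⟨hC, ENNReal.coe_lt_top⟩)
  have hmem : C' ∈ {C | C < ∞ ∧ HasMdNet Γ d S' C} := ⟨hlt, hnet'⟩
  exact (sInf_le hmem).trans hC'

/-! ### Orthogonal projections recognized by norms alone. -/

section SymmetricIdempotent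

variable {K : Type*} [NormedAddCommGroup K] [InnerProductSpace ℂ K]

/-- Pythagoras for `a + b`, with `a` in the range and `b` in the kernel, kills the real part of `⟨a,
b⟩`; replacing `b` by `i b` kills the imaginary part. So kernel and range are orthogonal. -/
theorem inner_idempotent_symm {E : K →L[ℂ] K} (hE : ∀ x, E (E x) = E x)
    (h : ∀ x, ‖x‖ ^ 2 = ‖E x‖ ^ 2 + ‖x - E x‖ ^ 2) (x y : K) :
    inner ℂ (E x) y = inner ℂ x (E y) := by
  have hre : ∀ a b, E a = a → E b = 0 → RCLike.re (inner ℂ a b : ℂ) = 0 := by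
    intro a b ha hb
    have h1 := h (a + b)
    rw [map_add, ha, hb, add_zero, add_sub_cancel_left, norm_add_sq (𝕜 := ℂ)] at h1
    linarith
  have hzero : ∀ a b, E a = a → E b = 0 → inner ℂ a b = 0 := by
    intro a b ha hb
    have h1 := hre a b ha hb
    have h2 := hre a (Complex.I • b) ha (by rw [map_smul, hb, smul_zero])
    rw [inner_smul_right] at h2
    refine Complex.ext h1 ?_
    simpa using h2
  have h1 := hzero (E x) (y - E y) (hE x) (by rw [map_sub, hE, sub_self])
  have h2 := hzero (E y) (x - E x) (hE y) (by rw [map_sub, hE, sub_self])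
  rw [inner_sub_right, sub_eq_zero] at h1 h2
  rw [h1, ← inner_conj_symm x, h2, inner_conj_symm]

theorem hasSum_of_hasSum_norm_sq {ι : Type*} {E : ι → K →L[ℂ] K}
    (symm : ∀ r x y, inner ℂ (E r x) y = inner ℂ x (E r y)) (idem : ∀ r x, E r (E r x) = E r x)
    (ortho : ∀ r s, r ≠ s → ∀ x, E r (E s x) = 0) {x : K}
    (h : HasSum (fun r => ‖E r x‖ ^ 2) (‖x‖ ^ 2)) : HasSum (fun r => E r x) x := by
  classical
  have h1 : ∀ r, inner ℂ x (E r x) = ((‖E r x‖ ^ 2 : ℝ) : ℂ) := by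
    intro r
    rw [← idem, ← symm, idem, inner_self_eq_norm_sq_to_K]
    norm_cast
  have key : ∀ F : Finset ι, ‖∑ r ∈ F, E r x - x‖ ^ 2 = ‖x‖ ^ 2 - ∑ r ∈ F, ‖E r x‖ ^ 2 := by
    intro F
    have h2 : inner ℂ (∑ r ∈ F, E r x) (∑ r ∈ F, E r x) =
        ((∑ r ∈ F, ‖E r x‖ ^ 2 : ℝ) : ℂ) := by
      rw [sum_inner, Complex.ofReal_sum]
      refine Finset.sum_congr rfl fun r hr => ?_
      rw [inner_sum, Finset.sum_eq_single r]
      · rw [symm, idem, h1]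
      · intro s _ hs
        rw [symm, ortho r s hs.symm, inner_zero_right]
      · exact fun hr' => (hr' hr).elim
    have h3 : inner ℂ x (∑ r ∈ F, E r x) = ((∑ r ∈ F, ‖E r x‖ ^ 2 : ℝ) : ℂ) := by
      rw [inner_sum, Complex.ofReal_sum]
      exact Finset.sum_congr rfl fun r _ => h1 r
    have h4 : ‖∑ r ∈ F, E r x‖ ^ 2 = ∑ r ∈ F, ‖E r x‖ ^ 2 := by
      rw [inner_self_eq_norm_sq_to_K] at h2
      exact Complex.ofReal_injective (by simpa using h2)
    rw [norm_sub_sq (𝕜 := ℂ), h4, ← inner_conj_symm, h3, Complex.conj_ofReal,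
      RCLike.re_to_complex, Complex.ofReal_re]
    ring
  rw [HasSum, tendsto_iff_norm_sub_tendsto_zero]
  have h5 : Tendsto (fun F : Finset ι => √(‖x‖ ^ 2 - ∑ r ∈ F, ‖E r x‖ ^ 2)) atTop (𝓝 0) := by
    have h6 := (tendsto_const_nhds (x := ‖x‖ ^ 2)).sub h
    rw [sub_self] at h6
    have h7 := (Real.continuous_sqrt.tendsto 0).comp h6
    rwa [Real.sqrt_zero] at h7
  refine h5.congr fun F => ?_
  rw [← key, Real.sqrt_sq (norm_nonneg _)]

end SymmetricIdempotent

/-! ### The Hilbert space of a quadratic gauge. -/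

/-- The square `x ↦ Tr(x* x)` of an extended Hilbertian norm on a complex vector space. -/
structure HilbertGauge (V : Type u) [AddCommGroup V] [Module ℂ V] where
  sq : V → ℝ≥0∞
  -- The case `s = 1` is the parallelogram law; varying `s` gives the triangle inequality. No
  -- subtraction of values occurs, as they may be infinite.
  sq_add : ∀ (s : ℝ), 0 < s → ∀ x y, sq (x + y) + sq ((s : ℂ) • x - ((s⁻¹ : ℝ) : ℂ) • y) =
    ENNReal.ofReal (1 + s ^ 2) * sq x + ENNReal.ofReal (1 + s⁻¹ ^ 2) * sq y
  sq_smul : ∀ (c : ℂ) x, sq (c • x) = ENNReal.ofReal (‖c‖ ^ 2) * sq x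
  eq_zero : ∀ x, sq x = 0 → x = 0

namespace HilbertGauge

variable {V : Type u} [AddCommGroup V] [Module ℂ V] (N : HilbertGauge V)

theorem sq_zero : N.sq 0 = 0 := by
  have := N.sq_smul 0 0
  simpa using this

theorem sq_add_le {s : ℝ} (hs : 0 < s) (x y : V) : N.sq (x + y) ≤
    ENNReal.ofReal (1 + s ^ 2) * N.sq x + ENNReal.ofReal (1 + s⁻¹ ^ 2) * N.sq y :=
  N.sq_add s hs x y ▸ le_self_add

/-- The vectors of finite norm. -/
def finite : Submodule ℂ V where
  carrier := {x | N.sq x < ∞}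
  zero_mem' := by
    change N.sq 0 < ∞
    rw [N.sq_zero]
    exact ENNReal.zero_lt_top
  add_mem' {x y} hx hy := by
    refine (N.sq_add_le one_pos x y).trans_lt (ENNReal.add_lt_top.2 ⟨?_, ?_⟩) <;>
    exact ENNReal.mul_lt_top ENNReal.ofReal_lt_top ‹_›
  smul_mem' c x hx := by
    change N.sq _ < ∞
    rw [N.sq_smul]
    exact ENNReal.mul_lt_top ENNReal.ofReal_lt_top hx

/-- The space of vectors of finite norm, with its norm. -/
def PreHilbert : Type u := N.finite

instance : AddCommGroup N.PreHilbert := inferInstanceAs (AddCommGroup N.finite)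

instance : Module ℂ N.PreHilbert := inferInstanceAs (Module ℂ N.finite)

/-- The inclusion of the vectors of finite norm. -/
def val : N.PreHilbert →ₗ[ℂ] V := N.finite.subtype

/-- A vector of finite norm. -/
def ofFinite (x : V) (hx : N.sq x < ∞) : N.PreHilbert := (⟨x, hx⟩ : N.finite)

theorem val_ofFinite (x : V) (hx : N.sq x < ∞) : N.val (N.ofFinite x hx) = x := rfl

theorem val_injective : Function.Injective N.val := Subtype.val_injective

theorem sq_val_lt_top (x : N.PreHilbert) : N.sq (N.val x) < ∞ := x.2

noncomputable instance : Norm N.PreHilbert := ⟨fun x => √((N.sq (N.val x)).toReal)⟩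

theorem norm_sq_eq (x : N.PreHilbert) : ‖x‖ ^ 2 = (N.sq (N.val x)).toReal :=
  Real.sq_sqrt ENNReal.toReal_nonneg

theorem norm_sq_add (s : ℝ) (hs : 0 < s) (x y : N.PreHilbert) :
    ‖x + y‖ ^ 2 + ‖(s : ℂ) • x - ((s⁻¹ : ℝ) : ℂ) • y‖ ^ 2 =
      (1 + s ^ 2) * ‖x‖ ^ 2 + (1 + s⁻¹ ^ 2) * ‖y‖ ^ 2 := by
  have h := congrArg ENNReal.toReal (N.sq_add s hs (N.val x) (N.val y))
  rw [← map_add, ← map_smul, ← map_smul, ← map_sub, ENNReal.toReal_add (N.sq_val_lt_top _).ne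
    (N.sq_val_lt_top _).ne, ENNReal.toReal_add (ENNReal.mul_lt_top ENNReal.ofReal_lt_top
    (N.sq_val_lt_top _)).ne (ENNReal.mul_lt_top ENNReal.ofReal_lt_top (N.sq_val_lt_top _)).ne,
    ENNReal.toReal_mul, ENNReal.toReal_mul, ENNReal.toReal_ofReal (by positivity),
    ENNReal.toReal_ofReal (by positivity)] at h
  simpa only [norm_sq_eq] using h

theorem normedSpaceCore : NormedSpace.Core ℂ N.PreHilbert where
  norm_nonneg x := Real.sqrt_nonneg _
  norm_smul c x := by
    have h1 : ‖c • x‖ ^ 2 = (‖c‖ * ‖x‖) ^ 2 := by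
      rw [norm_sq_eq, mul_pow, norm_sq_eq, map_smul, N.sq_smul, ENNReal.toReal_mul,
        ENNReal.toReal_ofReal (by positivity)]
    exact (sq_eq_sq₀ (Real.sqrt_nonneg _) (mul_nonneg (norm_nonneg _) (Real.sqrt_nonneg _))).1 h1
  norm_triangle x y := by
    have h0 : ∀ z : N.PreHilbert, 0 ≤ ‖z‖ := fun z => Real.sqrt_nonneg _
    have hlt : ∀ α β, ‖x‖ < α → ‖y‖ < β → ‖x + y‖ ≤ α + β := by
      intro α β hα hβ
      have hα0 := (h0 x).trans_lt hα
      have hβ0 := (h0 y).trans_lt hβ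
      -- `s² = β / α` makes the right side equal to `(α + β)²` when the norms are `α` and `β`;
      -- strict bounds keep both positive.
      have h1 := N.norm_sq_add (√(β / α)) (by positivity) x y
      rw [inv_pow, Real.sq_sqrt (by positivity)] at h1
      have h2 : ‖x‖ ^ 2 ≤ α ^ 2 := by gcongr; exact h0 x
      have h3 : ‖y‖ ^ 2 ≤ β ^ 2 := by gcongr; exact h0 y
      have h4 : (1 + β / α) * α ^ 2 + (1 + (β / α)⁻¹) * β ^ 2 = (α + β) ^ 2 := by
        field_simp; ring
      have h5 : (1 + β / α) * ‖x‖ ^ 2 ≤ (1 + β / α) * α ^ 2 := by gcongr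
      have h6 : (1 + (β / α)⁻¹) * ‖y‖ ^ 2 ≤ (1 + (β / α)⁻¹) * β ^ 2 := by gcongr
      refine abs_le_of_sq_le_sq' ?_ (by positivity) |>.2
      have h7 : 0 ≤ ‖((√(β / α) : ℝ) : ℂ) • x - (((√(β / α))⁻¹ : ℝ) : ℂ) • y‖ ^ 2 := by positivity
      linarith
    refine le_of_forall_pos_le_add fun ε hε => ?_
    have := hlt (‖x‖ + ε / 2) (‖y‖ + ε / 2) (by linarith) (by linarith)
    linarith
  norm_eq_zero_iff x := by
    constructor
    · intro h
      have h1 := N.norm_sq_eq x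
      rw [h] at h1
      have h2 : N.sq (N.val x) = 0 := by
        have h3 := (ENNReal.toReal_eq_zero_iff _).1 (h1.symm.trans (by norm_num))
        exact h3.resolve_right (N.sq_val_lt_top x).ne
      exact N.val_injective ((N.eq_zero _ h2).trans (map_zero _).symm)
    · rintro rfl
      change √((N.sq (N.val 0)).toReal) = 0
      rw [map_zero, N.sq_zero]
      simp

noncomputable instance : NormedAddCommGroup N.PreHilbert :=
  NormedAddCommGroup.ofCore N.normedSpaceCore

noncomputable instance : NormedSpace ℂ N.PreHilbert := NormedSpace.ofCore N.normedSpaceCore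

noncomputable instance : InnerProductSpace ℂ N.PreHilbert :=
  InnerProductSpace.ofNorm ℂ fun x y => by
    have h := N.norm_sq_add 1 one_pos x y
    simp only [inv_one, Complex.ofReal_one, one_smul] at h
    linarith

/-- The Hilbert space of a gauge. -/
def Space : Type u := UniformSpace.Completion N.PreHilbert

noncomputable instance : NormedAddCommGroup N.Space :=
  inferInstanceAs (NormedAddCommGroup (UniformSpace.Completion N.PreHilbert))

noncomputable instance : InnerProductSpace ℂ N.Space :=
  inferInstanceAs (InnerProductSpace ℂ (UniformSpace.Completion N.PreHilbert))

instance : CompleteSpace N.Space :=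
  inferInstanceAs (CompleteSpace (UniformSpace.Completion N.PreHilbert))

/-- The vectors of finite norm as elements of the Hilbert space. -/
noncomputable def toSpace : N.PreHilbert →L[ℂ] N.Space :=
  (UniformSpace.Completion.toComplL : N.PreHilbert →L[ℂ] UniformSpace.Completion N.PreHilbert)

theorem norm_toSpace (x : N.PreHilbert) : ‖N.toSpace x‖ = ‖x‖ := UniformSpace.Completion.norm_coe x

theorem denseRange_toSpace : DenseRange N.toSpace := UniformSpace.Completion.denseRange_coe

/-- A linear map that does not increase the gauge, on the vectors of finite norm. -/
def restrict (f : V →ₗ[ℂ] V) (hf : ∀ x, N.sq (f x) ≤ N.sq x) : N.PreHilbert →ₗ[ℂ] N.PreHilbert :=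
  f.restrict (p := N.finite) (q := N.finite) fun x hx => (hf x).trans_lt hx

theorem val_restrict (f : V →ₗ[ℂ] V) (hf : ∀ x, N.sq (f x) ≤ N.sq x) (x : N.PreHilbert) :
    N.val (N.restrict f hf x) = f (N.val x) := rfl

theorem norm_restrict_le (f : V →ₗ[ℂ] V) (hf : ∀ x, N.sq (f x) ≤ N.sq x) (x : N.PreHilbert) :
    ‖N.restrict f hf x‖ ≤ 1 * ‖x‖ := by
  rw [one_mul]
  refine Real.sqrt_le_sqrt (ENNReal.toReal_mono (N.sq_val_lt_top x).ne ?_)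
  exact hf (N.val x)

/-- The operator induced by a linear map that does not increase the gauge. -/
noncomputable def lift (f : V →ₗ[ℂ] V) (hf : ∀ x, N.sq (f x) ≤ N.sq x) : N.Space →L[ℂ] N.Space :=
  (((N.restrict f hf).mkContinuous 1 (N.norm_restrict_le f hf)).completion :
    UniformSpace.Completion N.PreHilbert →L[ℂ] UniformSpace.Completion N.PreHilbert)

theorem lift_toSpace (f : V →ₗ[ℂ] V) (hf : ∀ x, N.sq (f x) ≤ N.sq x) (x : N.PreHilbert) :
    N.lift f hf (N.toSpace x) = N.toSpace (N.restrict f hf x) :=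
  ContinuousLinearMap.completion_apply_coe _ x

theorem lift_toSpace_eq {f : V →ₗ[ℂ] V} (hf : ∀ x, N.sq (f x) ≤ N.sq x) {x y : N.PreHilbert}
    (h : f (N.val x) = N.val y) : N.lift f hf (N.toSpace x) = N.toSpace y := by
  rw [lift_toSpace]
  exact congrArg _ (N.val_injective h)

theorem ext_toSpace {W : Type*} [TopologicalSpace W] [T2Space W] {F F' : N.Space → W}
    (hF : Continuous F) (hF' : Continuous F') (h : ∀ x, F (N.toSpace x) = F' (N.toSpace x)) :
    F = F' :=
  N.denseRange_toSpace.equalizer hF hF' (funext h)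

theorem lift_lift_apply {f g k : V →ₗ[ℂ] V} (hf hg hk) (h : ∀ x, f (g x) = k x) (x : N.Space) :
    N.lift f hf (N.lift g hg x) = N.lift k hk x := by
  refine congrFun (N.ext_toSpace ((N.lift f hf).continuous.comp (N.lift g hg).continuous)
    (N.lift k hk).continuous fun x => ?_) x
  simp only [Function.comp, lift_toSpace]
  exact congrArg _ (N.val_injective (h _))

theorem lift_id_apply {f : V →ₗ[ℂ] V} (hf) (h : ∀ x, f x = x) (x : N.Space) :
    N.lift f hf x = x := by
  refine congrFun (N.ext_toSpace (N.lift f hf).continuous continuous_id fun x => ?_) x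
  exact N.lift_toSpace_eq hf (h _)

theorem lift_zero_apply {f : V →ₗ[ℂ] V} (hf) (h : ∀ x, f x = 0) (x : N.Space) :
    N.lift f hf x = 0 := by
  refine congrFun (N.ext_toSpace (N.lift f hf).continuous continuous_const fun x => ?_) x
  rw [N.lift_toSpace_eq hf (y := 0) (by rw [h, map_zero]), map_zero]

theorem norm_lift_apply {f : V →ₗ[ℂ] V} (hf) (h : ∀ x, N.sq (f x) = N.sq x) (x : N.Space) :
    ‖N.lift f hf x‖ = ‖x‖ := by
  refine congrFun (N.ext_toSpace (N.lift f hf).continuous.norm continuous_norm fun x => ?_) x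
  rw [lift_toSpace, norm_toSpace, norm_toSpace]
  change √((N.sq (f (N.val x))).toReal) = _
  rw [h]
  rfl

theorem inner_lift_symm {f : V →ₗ[ℂ] V} (hf) (hidem : ∀ x, f (f x) = f x)
    (h : ∀ x, N.sq x = N.sq (f x) + N.sq (x - f x)) (x y : N.Space) :
    inner ℂ (N.lift f hf x) y = inner ℂ x (N.lift f hf y) := by
  refine inner_idempotent_symm (fun x => N.lift_lift_apply hf hf hf hidem x) (fun x => ?_) x y
  refine congrFun (N.ext_toSpace (F := fun x => ‖x‖ ^ 2)
    (F' := fun x => ‖N.lift f hf x‖ ^ 2 + ‖x - N.lift f hf x‖ ^ 2) (by fun_prop) (by fun_prop)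
    fun x => ?_) x
  simp only [lift_toSpace]
  rw [← map_sub, norm_toSpace, norm_toSpace, norm_toSpace, norm_sq_eq, norm_sq_eq, norm_sq_eq,
    map_sub, val_restrict, ← ENNReal.toReal_add ((hf _).trans_lt (N.sq_val_lt_top x)).ne, ← h]
  exact ((h (N.val x)) ▸ le_add_self : N.sq (N.val x - f (N.val x)) ≤ _).trans_lt
    (N.sq_val_lt_top x) |>.ne

theorem isPartition_lift {ι : Type*} {f : ι → V →ₗ[ℂ] V} (hf : ∀ r x, N.sq (f r x) ≤ N.sq x)
    (hidem : ∀ r x, f r (f r x) = f r x) (h : ∀ r x, N.sq x = N.sq (f r x) + N.sq (x - f r x))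
    (hortho : ∀ r s, r ≠ s → ∀ x, f r (f s x) = 0) (hsum : ∀ x, ∑' r, N.sq (f r x) = N.sq x) :
    IsPartition fun r => N.lift (f r) (hf r) := by
  have symm := fun r => N.inner_lift_symm (hf r) (hidem r) (h r)
  have idem := fun r x => N.lift_lift_apply (hf r) (hf r) (hf r) (hidem r) x
  have ortho : ∀ r s, r ≠ s → ∀ x, N.lift (f r) (hf r) (N.lift (f s) (hf s) x) = 0 := by
    intro r s hrs x
    have h0 : ∀ x, N.sq ((0 : V →ₗ[ℂ] V) x) ≤ N.sq x := fun x => by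
      rw [LinearMap.zero_apply, N.sq_zero]; exact zero_le
    rw [N.lift_lift_apply (k := 0) (hf r) (hf s) h0 (hortho r s hrs)]
    exact N.lift_zero_apply _ (fun _ => rfl) x
  refine IsPartition.of_dense symm idem ortho N.denseRange_toSpace ?_
  rintro _ ⟨x, rfl⟩
  have h1 : HasSum (fun r => ‖N.lift (f r) (hf r) (N.toSpace x)‖ ^ 2) (‖N.toSpace x‖ ^ 2) := by
    have h2 := ENNReal.hasSum_toReal (f := fun r => N.sq (f r (N.val x)))
      (by rw [hsum]; exact (N.sq_val_lt_top x).ne)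
    rw [← ENNReal.tsum_toReal_eq (fun r => ((hf r _).trans_lt (N.sq_val_lt_top x)).ne), hsum] at h2
    simpa only [lift_toSpace, norm_toSpace, norm_sq_eq, val_restrict] using h2
  exact hasSum_of_hasSum_norm_sq symm idem ortho h1

end HilbertGauge

/-! ### The trace as a gauge on `M`. -/

section StarAlgebraIdentities

variable {A : Type*} [Ring A] [StarRing A]

theorem star_mul_self_eq_add {e : A} (he : IsStarProjection e) (x : A) :
    star x * x = star (e * x) * (e * x) + star (x - e * x) * (x - e * x) := by
  have h1 : star e = e := he.isSelfAdjoint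
  have h2 : e * (e * x) = e * x := by rw [← mul_assoc, he.isIdempotentElem]
  simp only [star_sub, star_mul, h1, sub_mul, mul_sub, mul_assoc, h2]
  abel

variable [Algebra ℂ A] [StarModule ℂ A]

theorem star_add_mul_add_add_star_sub_mul_sub (s : ℝ) (hs : 0 < s) (x y : A) :
    star (x + y) * (x + y) + star ((s : ℂ) • x - ((s⁻¹ : ℝ) : ℂ) • y) *
      ((s : ℂ) • x - ((s⁻¹ : ℝ) : ℂ) • y) =
    ((1 + s ^ 2 : ℝ) : ℂ) • (star x * x) + ((1 + s⁻¹ ^ 2 : ℝ) : ℂ) • (star y * y) := by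
  have h : (s : ℂ) * ((s⁻¹ : ℝ) : ℂ) = 1 := by
    rw [← Complex.ofReal_mul, mul_inv_cancel₀ hs.ne', Complex.ofReal_one]
  have h1 : ((1 + s ^ 2 : ℝ) : ℂ) = 1 + (s : ℂ) * s := by push_cast; ring
  have h2 : ((1 + s⁻¹ ^ 2 : ℝ) : ℂ) = 1 + ((s⁻¹ : ℝ) : ℂ) * ((s⁻¹ : ℝ) : ℂ) := by push_cast; ring
  rw [h1, h2]
  generalize ((s⁻¹ : ℝ) : ℂ) = t at h ⊢
  have ht : star t = t := by
    have h3 := congrArg star h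
    rw [star_mul, star_one, show star (s : ℂ) = s from Complex.conj_ofReal s] at h3
    exact mul_right_cancel₀ (b := (s : ℂ)) (by exact_mod_cast hs.ne') (h3.trans (by rw [mul_comm, h]))
  simp only [star_add, star_sub, star_smul, ht, show star (s : ℂ) = s from Complex.conj_ofReal s,
    add_mul, mul_add, sub_mul, mul_sub, smul_mul_assoc, mul_smul_comm, add_smul, smul_sub]
  simp only [smul_smul, mul_comm t (s : ℂ), h, one_smul]
  abel

end StarAlgebraIdentities

section Trace

variable {H : Type u} [NormedAddCommGroup H] [InnerProductSpace ℂ H] [CompleteSpace H]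
  {M : VonNeumannAlgebra H}

theorem VonNeumannAlgebra.star_mul_self_nonneg (x : M.toStarSubalgebra) : 0 ≤ star x * x :=
  _root_.star_mul_self_nonneg (x : H →L[ℂ] H)

theorem VonNeumannAlgebra.smul_star_mul_self_nonneg {c : ℝ} (hc : 0 ≤ c)
    (x : M.toStarSubalgebra) : 0 ≤ (c : ℂ) • (star x * x) := by
  have h := VonNeumannAlgebra.star_mul_self_nonneg (((√c : ℝ) : ℂ) • x)
  have h1 : star ((√c : ℝ) : ℂ) = ((√c : ℝ) : ℂ) := Complex.conj_ofReal _
  rwa [star_smul, smul_mul_smul_comm, h1, ← Complex.ofReal_mul, Real.mul_self_sqrt hc] at h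

namespace FNSTrace

variable (T : FNSTrace M)

theorem map_zero : T.toFun 0 = 0 := by
  have := T.map_smul 0 0 le_rfl
  simpa using this

theorem map_sum {ι : Type*} (F : Finset ι) (f : ι → M.toStarSubalgebra) (hf : ∀ i, 0 ≤ f i) :
    T.toFun (∑ i ∈ F, f i) = ∑ i ∈ F, T.toFun (f i) := by
  classical
  induction F using Finset.induction_on with
  | empty => simpa using T.map_zero
  | insert i F hi ih =>
    rw [Finset.sum_insert hi, Finset.sum_insert hi, T.map_add _ _ (hf i)
      (Finset.sum_nonneg fun i _ => hf i), ih]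

theorem map_ofReal_smul {c : ℝ} (hc : 0 ≤ c) {x : M.toStarSubalgebra} (hx : 0 ≤ x) :
    T.toFun ((c : ℂ) • x) = ENNReal.ofReal c * T.toFun x := by
  have := T.map_smul c.toNNReal x hx
  rwa [Real.coe_toNNReal _ hc] at this

/-- The gauge of the Hilbert space `L²(M, Tr)`. -/
noncomputable def gauge : HilbertGauge M.toStarSubalgebra where
  sq x := T.toFun (star x * x)
  sq_add s hs x y := by
    rw [← T.map_add _ _ (VonNeumannAlgebra.star_mul_self_nonneg _)
      (VonNeumannAlgebra.star_mul_self_nonneg _), star_add_mul_add_add_star_sub_mul_sub s hs,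
      ← T.map_ofReal_smul (by positivity) (VonNeumannAlgebra.star_mul_self_nonneg _),
      ← T.map_ofReal_smul (by positivity) (VonNeumannAlgebra.star_mul_self_nonneg _), T.map_add]
    all_goals exact VonNeumannAlgebra.smul_star_mul_self_nonneg (by positivity) _
  sq_smul c x := by
    rw [← T.map_ofReal_smul (by positivity) (VonNeumannAlgebra.star_mul_self_nonneg _)]
    congr 1
    rw [star_smul, smul_mul_smul_comm]
    congr 1
    rw [Complex.ofReal_pow, ← Complex.conj_mul']
    rfl
  eq_zero x hx := by
    have h1 := T.faithful _ (VonNeumannAlgebra.star_mul_self_nonneg x) hx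
    have h2 : star (x : H →L[ℂ] H) * x = 0 := congrArg Subtype.val h1
    exact Subtype.ext (CStarRing.star_mul_self_eq_zero_iff _ |>.1 h2)

theorem gauge_sq (x : M.toStarSubalgebra) : T.gauge.sq x = T.toFun (star x * x) := rfl

theorem gauge_sq_star (x : M.toStarSubalgebra) : T.gauge.sq (star x) = T.gauge.sq x := by
  rw [gauge_sq, gauge_sq, star_star, T.tracial]

theorem gauge_sq_eq_add_left {e : M.toStarSubalgebra} (he : IsStarProjection e)
    (x : M.toStarSubalgebra) :
    T.gauge.sq x = T.gauge.sq (e * x) + T.gauge.sq (x - e * x) := by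
  rw [gauge_sq, gauge_sq, gauge_sq, ← T.map_add _ _ (VonNeumannAlgebra.star_mul_self_nonneg _)
      (VonNeumannAlgebra.star_mul_self_nonneg _), ← star_mul_self_eq_add he]

theorem gauge_sq_eq_add_right {e : M.toStarSubalgebra} (he : IsStarProjection e)
    (x : M.toStarSubalgebra) :
    T.gauge.sq x = T.gauge.sq (x * e) + T.gauge.sq (x - x * e) := by
  have h : star e = e := he.isSelfAdjoint
  rw [← T.gauge_sq_star x, T.gauge_sq_eq_add_left he, ← T.gauge_sq_star (x * e),
    ← T.gauge_sq_star (x - x * e), star_sub, star_mul, h]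

end FNSTrace

section PartitionOfUnity

variable {ι : Type*} {e : ι → M.toStarSubalgebra}

theorem isPartition_of_isStarProjection (he : ∀ r, IsStarProjection (e r))
    (hsum : ∀ v : H, HasSum (fun r => (e r : H →L[ℂ] H) v) v) :
    IsPartition fun r => (e r : H →L[ℂ] H) where
  symm r x y := by
    have h1 : star (e r : H →L[ℂ] H) = e r := congrArg Subtype.val (he r).isSelfAdjoint.star_eq
    nth_rewrite 2 [← h1]
    rw [ContinuousLinearMap.star_eq_adjoint, ContinuousLinearMap.adjoint_inner_right]
  idem r x := by
    have h1 : (e r : H →L[ℂ] H) * e r = e r := congrArg Subtype.val (he r).isIdempotentElem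
    exact congrArg (fun T : H →L[ℂ] H => T x) h1
  hasSum := hsum

theorem mul_eq_zero_of_partition (he : ∀ r, IsStarProjection (e r))
    (hsum : ∀ v : H, HasSum (fun r => (e r : H →L[ℂ] H) v) v) {r s : ι} (hrs : r ≠ s) :
    e r * e s = 0 :=
  Subtype.ext (ContinuousLinearMap.ext
    ((isPartition_of_isStarProjection he hsum).apply_apply_of_ne hrs))

/-- Supplies the supremum to which normality of the trace applies. Finite sums of the `e r` are
projections, hence the upper bound; it is least because the quadratic forms of the finite sums at
`v` converge to `‖x v‖ ^ 2`. -/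
theorem isLUB_sum_star_mul_self (he : ∀ r, IsStarProjection (e r))
    (hsum : ∀ v : H, HasSum (fun r => (e r : H →L[ℂ] H) v) v) (x : M.toStarSubalgebra) :
    IsLUB (Set.range fun F : Finset ι => ∑ r ∈ F, star (e r * x) * (e r * x)) (star x * x) := by
  classical
  have hp := isPartition_of_isStarProjection he hsum
  constructor
  · rintro _ ⟨F, rfl⟩
    have h1 : ∀ r, star (e r * x) * (e r * x) = star x * (e r * x) := fun r => by
      have h2 : star (e r) = e r := (he r).isSelfAdjoint
      rw [star_mul, h2, mul_assoc, ← mul_assoc (e r), (he r).isIdempotentElem]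
    have hproj : IsStarProjection (∑ r ∈ F, e r) := by
      constructor
      · change (∑ r ∈ F, e r) * ∑ r ∈ F, e r = ∑ r ∈ F, e r
        rw [Finset.sum_mul_sum]
        refine Finset.sum_congr rfl fun r hr => ?_
        rw [Finset.sum_eq_single r, (he r).isIdempotentElem]
        · exact fun s _ hs => mul_eq_zero_of_partition he hsum hs.symm
        · exact fun h => (h hr).elim
      · change star (∑ r ∈ F, e r) = _
        rw [star_sum]
        exact Finset.sum_congr rfl fun r _ => (he r).isSelfAdjoint
    have h3 : star ((∑ r ∈ F, e r) * x) * ((∑ r ∈ F, e r) * x) =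
        ∑ r ∈ F, star (e r * x) * (e r * x) := by
      have h4 : star (∑ r ∈ F, e r) = ∑ r ∈ F, e r := hproj.isSelfAdjoint
      simp only [h1]
      rw [star_mul, h4, mul_assoc, ← mul_assoc (∑ r ∈ F, e r), hproj.isIdempotentElem,
        Finset.sum_mul, Finset.mul_sum]
    change (∑ r ∈ F, star (e r * x) * (e r * x)) ≤ star x * x
    rw [star_mul_self_eq_add hproj x, h3]
    exact le_add_of_nonneg_right (VonNeumannAlgebra.star_mul_self_nonneg _)
  · intro b hb
    have hb0 : 0 ≤ b := by simpa using hb ⟨∅, rfl⟩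
    have hquad : ∀ (y : M.toStarSubalgebra) (v : H),
        inner ℂ (((star y * y : M.toStarSubalgebra) : H →L[ℂ] H) v) v =
          ((‖(y : H →L[ℂ] H) v‖ ^ 2 : ℝ) : ℂ) := by
      intro y v
      have h1 : ((star y * y : M.toStarSubalgebra) : H →L[ℂ] H) v =
          ContinuousLinearMap.adjoint (y : H →L[ℂ] H) ((y : H →L[ℂ] H) v) := rfl
      rw [h1, ContinuousLinearMap.adjoint_inner_left, inner_self_eq_norm_sq_to_K]
      norm_cast
    have hbpos := (ContinuousLinearMap.isPositive_iff_complex _).1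
      ((ContinuousLinearMap.nonneg_iff_isPositive _).1 (show 0 ≤ (b : H →L[ℂ] H) from hb0))
    change ((star x * x : M.toStarSubalgebra) : H →L[ℂ] H) ≤ b
    rw [ContinuousLinearMap.le_def, ContinuousLinearMap.isPositive_iff_complex]
    intro v
    have h5 : inner ℂ (((b : H →L[ℂ] H) - ((star x * x : M.toStarSubalgebra) : H →L[ℂ] H)) v) v =
        ((RCLike.re (inner ℂ ((b : H →L[ℂ] H) v) v) - ‖(x : H →L[ℂ] H) v‖ ^ 2 : ℝ) : ℂ) := by
      rw [sub_apply, inner_sub_left, hquad, Complex.ofReal_sub]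
      congr 1
      exact (hbpos v).1.symm
    rw [h5]
    refine ⟨by rw [RCLike.re_to_complex, Complex.ofReal_re], ?_⟩
    rw [RCLike.re_to_complex, Complex.ofReal_re, sub_nonneg]
    refine le_of_tendsto (hp.hasSum_norm_sq ((x : H →L[ℂ] H) v))
      (Eventually.of_forall fun F => ?_)
    have h6 : ((∑ r ∈ F, star (e r * x) * (e r * x) : M.toStarSubalgebra) : H →L[ℂ] H) ≤ b :=
      hb ⟨F, rfl⟩
    rw [ContinuousLinearMap.le_def, ContinuousLinearMap.isPositive_iff_complex] at h6
    have h7 := (h6 v).2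
    have h8 : inner ℂ (((∑ r ∈ F, star (e r * x) * (e r * x) : M.toStarSubalgebra) :
        H →L[ℂ] H) v) v = ((∑ r ∈ F, ‖(e r : H →L[ℂ] H) ((x : H →L[ℂ] H) v)‖ ^ 2 : ℝ) : ℂ) := by
      have h9 : ((∑ r ∈ F, star (e r * x) * (e r * x) : M.toStarSubalgebra) : H →L[ℂ] H) =
          ∑ r ∈ F, ((star (e r * x) * (e r * x) : M.toStarSubalgebra) : H →L[ℂ] H) :=
        map_sum M.toStarSubalgebra.subtype _ _
      rw [h9, sum_apply, sum_inner, Complex.ofReal_sum]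
      exact Finset.sum_congr rfl fun r _ => hquad (e r * x) v
    rw [sub_apply, inner_sub_left, h8, _root_.map_sub, RCLike.re_to_complex,
      RCLike.re_to_complex, Complex.ofReal_re, sub_nonneg] at h7
    exact h7

theorem FNSTrace.tsum_gauge_sq_mul_left (T : FNSTrace M) (he : ∀ r, IsStarProjection (e r))
    (hsum : ∀ v : H, HasSum (fun r => (e r : H →L[ℂ] H) v) v) (x : M.toStarSubalgebra) :
    ∑' r, T.gauge.sq (e r * x) = T.gauge.sq x := by
  classical
  have hpos : ∀ r, 0 ≤ star (e r * x) * (e r * x) := fun r =>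
    VonNeumannAlgebra.star_mul_self_nonneg _
  rw [T.gauge_sq x, T.normal _ _ (Set.range_nonempty _) ?_ ?_ (isLUB_sum_star_mul_self he hsum x),
    iSup_range, ENNReal.tsum_eq_iSup_sum]
  · exact iSup_congr fun F => (T.map_sum F _ hpos).symm
  · rintro _ ⟨F, rfl⟩
    exact Finset.sum_nonneg fun r _ => hpos r
  · rintro _ ⟨F, rfl⟩ _ ⟨F', rfl⟩
    refine ⟨_, ⟨F ∪ F', rfl⟩, ?_, ?_⟩
    · exact Finset.sum_le_sum_of_subset_of_nonneg Finset.subset_union_left fun r _ _ => hpos r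
    · exact Finset.sum_le_sum_of_subset_of_nonneg Finset.subset_union_right fun r _ _ => hpos r

/-- The adjoint exchanges the two sides and, the trace being tracial, preserves the gauge. -/
theorem FNSTrace.tsum_gauge_sq_mul_right (T : FNSTrace M) (he : ∀ r, IsStarProjection (e r))
    (hsum : ∀ v : H, HasSum (fun r => (e r : H →L[ℂ] H) v) v) (x : M.toStarSubalgebra) :
    ∑' r, T.gauge.sq (x * e r) = T.gauge.sq x := by
  rw [← T.gauge_sq_star x, ← T.tsum_gauge_sq_mul_left he hsum]
  refine tsum_congr fun r => ?_
  have h : star (e r) = e r := (he r).isSelfAdjoint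
  rw [← T.gauge_sq_star, star_mul, h]

end PartitionOfUnity

end Trace

/-! ### Multiplications and the action on `L²(M, Tr)`. -/

section StandardForm

variable {H : Type u} [NormedAddCommGroup H] [InnerProductSpace ℂ H] [CompleteSpace H]
  {M : VonNeumannAlgebra H}

/-- Multiplication from the left (`true`) or from the right (`false`). -/
noncomputable def mulSide : Bool → M.toStarSubalgebra → M.toStarSubalgebra →ₗ[ℂ] M.toStarSubalgebra
  | true, e => LinearMap.mulLeft ℂ e
  | false, e => LinearMap.mulRight ℂ e

theorem mulSide_not_comm (b : Bool) (e f x : M.toStarSubalgebra) :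
    mulSide b e (mulSide (!b) f x) = mulSide (!b) f (mulSide b e x) := by
  cases b
  · exact mul_assoc f x e
  · exact (mul_assoc e x f).symm

/-- The source of `conj_ζ`, used with `e = σ g p` and `f = p`. -/
theorem mulSide_not (b : Bool) (e f : M.toStarSubalgebra) : mulSide b e f = mulSide (!b) f e := by
  cases b <;> rfl

theorem mulSide_self {e : M.toStarSubalgebra} (he : IsStarProjection e) (b : Bool) :
    mulSide b e e = e := by
  cases b <;> exact he.isIdempotentElem

theorem mulSide_mulSide (b : Bool) {e : M.toStarSubalgebra} (he : IsStarProjection e)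
    (x : M.toStarSubalgebra) : mulSide b e (mulSide b e x) = mulSide b e x := by
  have h : e * e = e := he.isIdempotentElem
  cases b
  · exact (mul_assoc x e e).trans (congrArg _ h)
  · exact (mul_assoc e e x).symm.trans (congrArg (· * x) h)

theorem mulSide_mulSide_eq_zero (b : Bool) {e f : M.toStarSubalgebra} (hef : e * f = 0)
    (hfe : f * e = 0) (x : M.toStarSubalgebra) : mulSide b e (mulSide b f x) = 0 := by
  cases b
  · exact (mul_assoc x f e).trans (by rw [hfe, mul_zero])
  · exact (mul_assoc e f x).symm.trans (by rw [hef, zero_mul])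

/-- A `*`-automorphism as a linear map. -/
noncomputable def autMap (α : M.toStarSubalgebra ≃⋆ₐ[ℂ] M.toStarSubalgebra) :
    M.toStarSubalgebra →ₗ[ℂ] M.toStarSubalgebra where
  toFun := α
  map_add' := map_add α
  map_smul' := map_smul α

theorem autMap_mulSide (α : M.toStarSubalgebra ≃⋆ₐ[ℂ] M.toStarSubalgebra) (b : Bool)
    (e x : M.toStarSubalgebra) : autMap α (mulSide b e x) = mulSide b (α e) (autMap α x) := by
  cases b <;> exact map_mul α _ _

theorem apply_apply_inv {G K : Type*} [Group G] [NormedAddCommGroup K] [InnerProductSpace ℂ K]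
    (ρ : G →* (K →L[ℂ] K)) (g : G) (x : K) : ρ g (ρ g⁻¹ x) = x := by
  have h : ρ g * ρ g⁻¹ = 1 := by rw [← ρ.map_mul, mul_inv_cancel, ρ.map_one]
  exact congrArg (fun F : K →L[ℂ] K => F x) h

namespace FNSTrace

variable (T : FNSTrace M)

theorem gauge_sq_eq_add_mulSide (b : Bool) {e : M.toStarSubalgebra} (he : IsStarProjection e)
    (x : M.toStarSubalgebra) :
    T.gauge.sq x = T.gauge.sq (mulSide b e x) + T.gauge.sq (x - mulSide b e x) := by
  cases b
  · exact T.gauge_sq_eq_add_right he x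
  · exact T.gauge_sq_eq_add_left he x

theorem gauge_sq_mulSide_le (b : Bool) {e : M.toStarSubalgebra} (he : IsStarProjection e)
    (x : M.toStarSubalgebra) : T.gauge.sq (mulSide b e x) ≤ T.gauge.sq x :=
  T.gauge_sq_eq_add_mulSide b he x ▸ le_self_add

theorem isPartition_mulSide (b : Bool) {ι : Type*} {e : ι → M.toStarSubalgebra}
    (he : ∀ r, IsStarProjection (e r))
    (hsum : ∀ v : H, HasSum (fun r => (e r : H →L[ℂ] H) v) v) :
    IsPartition fun r => T.gauge.lift (mulSide b (e r)) (T.gauge_sq_mulSide_le b (he r)) := by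
  refine T.gauge.isPartition_lift (fun r => T.gauge_sq_mulSide_le b (he r))
    (fun r => mulSide_mulSide b (he r)) (fun r => T.gauge_sq_eq_add_mulSide b (he r))
    (fun r s hrs => mulSide_mulSide_eq_zero b (mul_eq_zero_of_partition he hsum hrs)
      (mul_eq_zero_of_partition he hsum hrs.symm)) fun x => ?_
  cases b
  · exact T.tsum_gauge_sq_mul_right he hsum x
  · exact T.tsum_gauge_sq_mul_left he hsum x

section Action

variable {T} {G : Type*} [Group G] {σ : G →* (M.toStarSubalgebra ≃⋆ₐ[ℂ] M.toStarSubalgebra)}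

theorem gauge_sq_autMap (hσ : ∀ g x, 0 ≤ x → T.toFun (σ g x) = T.toFun x) (g : G)
    (x : M.toStarSubalgebra) : T.gauge.sq (autMap (σ g) x) = T.gauge.sq x := by
  have h : star (σ g x) * σ g x = σ g (star x * x) := by rw [map_mul, map_star]
  change T.toFun (star (σ g x) * σ g x) = _
  rw [h, hσ _ _ (VonNeumannAlgebra.star_mul_self_nonneg x), gauge_sq]

/-- The unitary representation on `L²(M, Tr)` of a trace preserving action. -/
noncomputable def koopman (hσ : ∀ g x, 0 ≤ x → T.toFun (σ g x) = T.toFun x) :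
    G →* (T.gauge.Space →L[ℂ] T.gauge.Space) where
  toFun g := T.gauge.lift (autMap (σ g)) fun x => (gauge_sq_autMap hσ g x).le
  map_one' := ContinuousLinearMap.ext fun x => T.gauge.lift_id_apply _
    (fun x => by rw [map_one]; rfl) x
  map_mul' g h := ContinuousLinearMap.ext fun x => (T.gauge.lift_lift_apply _ _ _
    (fun x => by rw [map_mul]; rfl) x).symm

variable (hσ : ∀ g x, 0 ≤ x → T.toFun (σ g x) = T.toFun x)

theorem inner_koopman (g : G) (x y : T.gauge.Space) :
    inner ℂ (koopman hσ g x) y = inner ℂ x (koopman hσ g⁻¹ y) := by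
  have h1 := (LinearMap.norm_map_iff_inner_map_map (koopman hσ g)).1
    (T.gauge.norm_lift_apply _ (gauge_sq_autMap hσ g)) x (koopman hσ g⁻¹ y)
  rwa [apply_apply_inv (koopman hσ)] at h1

theorem koopman_mulSide (b : Bool) {e : M.toStarSubalgebra} (he : IsStarProjection e) (g : G)
    (heg : IsStarProjection (σ g e)) (x : T.gauge.Space) :
    koopman hσ g (T.gauge.lift (mulSide b e) (T.gauge_sq_mulSide_le b he) (koopman hσ g⁻¹ x)) =
      T.gauge.lift (mulSide b (σ g e)) (T.gauge_sq_mulSide_le b heg) x := by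
  have h1 : ∀ x, T.gauge.sq ((mulSide b e ∘ₗ autMap (σ g⁻¹)) x) ≤ T.gauge.sq x := fun x =>
    (T.gauge_sq_mulSide_le b he _).trans (gauge_sq_autMap hσ _ x).le
  have h2 := T.gauge.lift_lift_apply (T.gauge_sq_mulSide_le b he)
    (fun x => (gauge_sq_autMap hσ g⁻¹ x).le) h1 (fun _ => rfl) x
  refine (congrArg _ h2).trans (T.gauge.lift_lift_apply _ _ _ (fun x => ?_) x)
  have h3 : autMap (σ g) (autMap (σ g⁻¹) x) = x := by
    have h4 : σ g * σ g⁻¹ = 1 := by rw [← map_mul, mul_inv_cancel, map_one]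
    exact congrArg (fun α : M.toStarSubalgebra ≃⋆ₐ[ℂ] M.toStarSubalgebra => α x) h4
  rw [LinearMap.comp_apply, autMap_mulSide, h3]

theorem isPartition_koopman_mulSide (b : Bool) {e : M.toStarSubalgebra} (he : IsStarProjection e)
    {ι : Type*} (r : ι → G) (hsum : ∀ v : H, HasSum (fun i => (σ (r i) e : H →L[ℂ] H) v) v) :
    IsPartition fun i => (koopman hσ (r i)).comp
      ((T.gauge.lift (mulSide b e) (T.gauge_sq_mulSide_le b he)).comp (koopman hσ (r i)⁻¹)) := by
  have h := T.isPartition_mulSide b (fun i => he.map (σ (r i))) hsum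
  convert h using 2 with i
  exact ContinuousLinearMap.ext (koopman_mulSide hσ b he (r i) (he.map (σ (r i))))

theorem mulSide_comm (b : Bool) {e f : M.toStarSubalgebra} (he : IsStarProjection e)
    (hf : IsStarProjection f) (x : T.gauge.Space) :
    T.gauge.lift (mulSide b e) (T.gauge_sq_mulSide_le b he)
      (T.gauge.lift (mulSide (!b) f) (T.gauge_sq_mulSide_le (!b) hf) x) =
    T.gauge.lift (mulSide (!b) f) (T.gauge_sq_mulSide_le (!b) hf)
      (T.gauge.lift (mulSide b e) (T.gauge_sq_mulSide_le b he) x) := by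
  have h : ∀ x, T.gauge.sq ((mulSide b e ∘ₗ mulSide (!b) f) x) ≤ T.gauge.sq x := fun x =>
    (T.gauge_sq_mulSide_le b he _).trans (T.gauge_sq_mulSide_le _ hf x)
  rw [T.gauge.lift_lift_apply _ _ h (fun _ => rfl),
    T.gauge.lift_lift_apply _ _ h fun x => (mulSide_not_comm b e f x).symm]

end Action

end FNSTrace

end StandardForm

/-! ### From von Neumann equivalence to the theorem. -/

namespace VNE

variable {Γ Λ : Type u} [Group Γ] [Group Λ]

theorem symm (h : VNE Γ Λ) : VNE Λ Γ := by
  obtain ⟨H, _, _, _, _, M, T, σ, p, q, hσ, hp, hq, hTp, hTq⟩ := h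
  exact ⟨H, _, _, ‹_›, ‹_›, M, T, σ.comp (MulEquiv.prodComm : Λ × Γ ≃* Γ × Λ).toMonoidHom, q, p,
    fun a x hx => hσ _ x hx, hq, hp, hTq, hTp⟩

/-- `P true` and `P false` are left and right multiplication by `p`, and `ζ` is `p` itself,
normalized; it belongs to `L²(M, Tr)` because `p` has finite trace. -/
theorem nonempty_inductionDatum (h : VNE Γ Λ) : Nonempty (InductionDatum Γ Λ) := by
  obtain ⟨H, _, _, _, _, M, T, σ, p, q, hσ, ⟨hp, hpsum⟩, ⟨hq, hqsum⟩, hTp, hTq⟩ := h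
  have hfin : ∀ g, T.gauge.sq (σ g p) < ∞ := fun g => by
    change T.gauge.sq (autMap (σ g) p) < ∞
    have h1 : star p * p = p := by rw [hp.isSelfAdjoint.star_eq, hp.isIdempotentElem]
    rwa [FNSTrace.gauge_sq_autMap hσ, T.gauge_sq, h1]
  have hfin1 : T.gauge.sq p < ∞ := by
    have := hfin 1
    rwa [map_one] at this
  let η := T.gauge.toSpace (T.gauge.ofFinite p hfin1)
  -- If `p` were zero, its translates could not sum to the identity of the nonzero space `H`.
  have hη : η ≠ 0 := by
    intro h0
    have h1 : ‖T.gauge.ofFinite p hfin1‖ ^ 2 = 0 := by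
      rw [← T.gauge.norm_toSpace]
      change ‖η‖ ^ 2 = 0
      rw [h0, norm_zero, zero_pow two_ne_zero]
    rw [T.gauge.norm_sq_eq, T.gauge.val_ofFinite, ENNReal.toReal_eq_zero_iff] at h1
    have h2 : p = 0 := T.gauge.eq_zero _ (h1.resolve_right hfin1.ne)
    obtain ⟨v, hv⟩ := exists_ne (0 : H)
    refine hv ((hpsum v).unique ?_)
    convert hasSum_zero using 2 with s
    rw [h2, map_zero]
    rfl
  have hPη : ∀ b, T.gauge.lift (mulSide b p) (T.gauge_sq_mulSide_le b hp) η = η := fun b =>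
    T.gauge.lift_toSpace_eq _ (mulSide_self hp b)
  have hconj : ∀ b g, FNSTrace.koopman hσ g (T.gauge.lift (mulSide b p)
      (T.gauge_sq_mulSide_le b hp) (FNSTrace.koopman hσ g⁻¹ η)) =
      T.gauge.lift (mulSide (!b) p) (T.gauge_sq_mulSide_le (!b) hp)
        (FNSTrace.koopman hσ g η) := by
    intro b g
    have h1 : FNSTrace.koopman hσ g η = T.gauge.toSpace (T.gauge.ofFinite (σ g p) (hfin g)) :=
      T.gauge.lift_toSpace_eq _ rfl
    rw [FNSTrace.koopman_mulSide hσ b hp g (hp.map (σ g)), h1, T.gauge.lift_toSpace]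
    exact (T.gauge.lift_toSpace_eq _ (mulSide_not b (σ g p) p).symm).symm
  exact ⟨{
    L := T.gauge.Space
    u := FNSTrace.koopman hσ
    inner_u := FNSTrace.inner_koopman hσ
    P := fun b => T.gauge.lift (mulSide b p) (T.gauge_sq_mulSide_le b hp)
    Q := T.gauge.lift (mulSide true q) (T.gauge_sq_mulSide_le true hq)
    ζ := ((‖η‖⁻¹ : ℝ) : ℂ) • η
    partition_P := fun b => FNSTrace.isPartition_koopman_mulSide hσ b hp (fun s => (1, s)) hpsum
    partition_Q := FNSTrace.isPartition_koopman_mulSide hσ true hq (fun γ => (γ, 1)) hqsum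
    comm := fun b g x => (FNSTrace.koopman_mulSide hσ b hp g (hp.map (σ g)) _).trans
      ((FNSTrace.mulSide_comm b (hp.map (σ g)) hp x).trans
        (congrArg _ (FNSTrace.koopman_mulSide hσ b hp g (hp.map (σ g)) x).symm))
    P_ζ := fun b => by rw [map_smul, hPη]
    conj_ζ := fun b g => by simp only [map_smul, hconj]
    norm_ζ := by
      rw [norm_smul, Complex.norm_real, norm_inv, norm_norm,
        inv_mul_cancel₀ (norm_ne_zero_iff.2 hη)] }⟩

end VNE

theorem InductionDatum.mdAP {Γ Λ : Type u} [Group Γ] [Group Λ] (D : InductionDatum Γ Λ) {d : ℕ}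
    (hd : 0 < d) (h : MdAP Λ d) : MdAP Γ d := by
  obtain ⟨C, hC⟩ := h
  obtain ⟨C', -, hC'⟩ := D.exists_hasMdNet hd
    (fun _ hφ _ hε => D.exists_approx_fourierAlgebra hd hφ hε) hC one_pos
  exact ⟨C', hC'⟩

theorem InductionDatum.mdWeaklyAmenable {Γ Λ : Type u} [Group Γ] [Group Λ]
    (D : InductionDatum Γ Λ) {d : ℕ} (hd : 0 < d) (h : MdWeaklyAmenable Λ d) :
    MdWeaklyAmenable Γ d := by
  obtain ⟨C, hC, hnet⟩ := h
  obtain ⟨C', hle, hnet'⟩ := D.exists_hasMdNet hd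
    (fun _ hφ _ hε => D.exists_approx_fourierAlgebra hd hφ hε) hnet one_pos
  exact ⟨C', hle.trans_lt (ENNReal.add_lt_top.2 ⟨hC, ENNReal.ofReal_lt_top⟩), hnet'⟩

theorem InductionDatum.mdWeakHaagerup {Γ Λ : Type u} [Group Γ] [Group Λ]
    (D : InductionDatum Γ Λ) {d : ℕ} (hd : 0 < d) (h : MdWeakHaagerup Λ d) :
    MdWeakHaagerup Γ d := by
  obtain ⟨C, hC, hnet⟩ := h
  obtain ⟨C', hle, hnet'⟩ := D.exists_hasMdNet hd
    (fun _ hφ _ hε => D.exists_approx_cZero hd hφ hε) hnet one_pos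
  exact ⟨C', hle.trans_lt (ENNReal.add_lt_top.2 ⟨hC, ENNReal.ofReal_lt_top⟩), hnet'⟩

theorem InductionDatum.cowlingHaagerup_le {Γ Λ : Type u} [Group Γ] [Group Λ]
    (D : InductionDatum Γ Λ) {d : ℕ} (hd : 0 < d) : cowlingHaagerup Γ d ≤ cowlingHaagerup Λ d :=
  sInf_hasMdNet_le fun _ hC _ hε => D.exists_hasMdNet hd
    (fun _ hφ _ hε => D.exists_approx_fourierAlgebra hd hφ hε) hC hε

theorem InductionDatum.weakHaagerupConst_le {Γ Λ : Type u} [Group Γ] [Group Λ]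
    (D : InductionDatum Γ Λ) {d : ℕ} (hd : 0 < d) :
    weakHaagerupConst Γ d ≤ weakHaagerupConst Λ d :=
  sInf_hasMdNet_le fun _ hC _ hε => D.exists_hasMdNet hd
    (fun _ hφ _ hε => D.exists_approx_cZero hd hφ hε) hC hε

theorem theorem1p1 (d : ℕ) (hd : 2 ≤ d) (Γ Λ : Type u) [Group Γ] [Group Λ]
    (h : VNE Γ Λ) :
    (MdAP Γ d ↔ MdAP Λ d) ∧
    ((MdWeaklyAmenable Γ d ↔ MdWeaklyAmenable Λ d) ∧
      cowlingHaagerup Γ d = cowlingHaagerup Λ d) ∧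
    ((MdWeakHaagerup Γ d ↔ MdWeakHaagerup Λ d) ∧
      weakHaagerupConst Γ d = weakHaagerupConst Λ d) := by
  have hd' : 0 < d := two_pos.trans_le hd
  obtain ⟨D⟩ := h.nonempty_inductionDatum
  obtain ⟨D'⟩ := h.symm.nonempty_inductionDatum
  exact ⟨⟨D'.mdAP hd', D.mdAP hd'⟩,
    ⟨⟨D'.mdWeaklyAmenable hd', D.mdWeaklyAmenable hd'⟩,
      (D.cowlingHaagerup_le hd').antisymm (D'.cowlingHaagerup_le hd')⟩,
    ⟨⟨D'.mdWeakHaagerup hd', D.mdWeakHaagerup hd'⟩,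
      (D.weakHaagerupConst_le hd').antisymm (D'.weakHaagerupConst_le hd')⟩⟩
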